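/- Let $d\in\{2,3\}$, let $\Omega\subset\mathbb R^d$ be a polygonal/polyhedral domain (bounded, connected, open, with Lipschitz boundary contained in finitely many hyperplanes), and let $\mathcal T_h$ be a finite partition of $\Omega$ into polygonal/polyhedral domains $T$ of the same kind, with set of edges/flat faces $\mathcal E_h$; write $\mathbf n$ for the outward unit normal on $\partial T$. Let $k\ge 1$ be an integer, and let $P_r(T)$, $P_r(e)$ denote the polynomials of degree at most $r$ on $T$, $e$. For a weak function $\mathbf v=\{\mathbf v_0,\mathbf v_b\}$ on $T$, the discrete weak gradient $\nabla_w\mathbf v\in[P_{k-1}(T)]^{d\times d}$ and the discrete weak divergence $\nabla_w\cdot\mathbf v\in P_{k-1}(T)$ are the unique polynomials with $$(\nabla_w\mathbf v,q)_T=-(\mathbf v_0,\nabla\cdot q)_T+\langle\mathbf v_b,q\mathbf n\rangle_{\partial T}\quad\forall q\in[P_{k-1}(T)]^{d\times d},$$ $$(\nabla_w\cdot\mathbf v,\varphi)_T=-(\mathbf v_0,\nabla\varphi)_T+\langle\mathbf v_b\cdot\mathbf n,\varphi\rangle_{\partial T}\quad\forall\varphi\in P_{k-1}(T),$$ where the gradient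 $(\nabla\mathbf v)_{ij}=\partial_j v_i$ and the divergence $(\nabla\cdot q)_i=\sum_j\partial_jq_{ij}$ are taken row by row. Let $Q_0$ be the $L^2$ projection onto $[P_k(T)]^d$ on each $T\in\mathcal T_h$, let $Q_b$ be the $L^2$ projection from $[L^2(e)]^d$ onto $[P_{k-1}(e)]^d$ on each $e\in\mathcal E_h$, and let $\mathbf Q_h$ and $\mathbb Q_h$ be the $L^2$ projections onto $[P_{k-1}(T)]^{d\times d}$ and $P_{k-1}(T)$ on each $T$. Put $Q_h\mathbf v=\{Q_0\mathbf v,Q_b\mathbf v\}$, where $Q_b$ is applied to the boundary values of $\mathbf v$ on the faces. 1. Every $\mathbf v\in[H^1(\Omega)]^d$ has a trace in $L^2$ on the union of the faces, and with this trace, on every $T\in\mathcal T_h$, $$\nabla_w(Q_h\mathbf v)=\mathbf Q_h(\nabla\mathbf v),\qquad \nabla_w\cdot(Q_h\mathbf v)=\mathbb Q_h(\nabla\cdot\mathbf v).$$ 2. Let $\mathbf v\in H(\mathrm{div},\Omega)$ have square integrable boundary values on the faces, i.e. let there be a field $\mathbf v_b$ with $\mathbf v_b|_e\in[L^2(e)]^d$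 for all $e\in\mathcal E_h$ such that, for every $T\in\mathcal T_h$, the normal trace of $\mathbf v$ on $\partial T$ is $\mathbf v_b\cdot\mathbf n$. Then, with $Q_h\mathbf v=\{Q_0\mathbf v,Q_b\mathbf v_b\}$, on every $T\in\mathcal T_h$, $$\nabla_w\cdot(Q_h\mathbf v)=\mathbb Q_h(\nabla\cdot\mathbf v).$$ -/

import Mathlib

open MeasureTheory Filter Topology
open scoped ContDiff

noncomputable section

namespace WG

/-- The Euclidean space `ℝᵈ`. -/
abbrev E (d : ℕ) : Type := EuclideanSpace ℝ (Fin d)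

/-- Scalar-valued functions on `ℝᵈ`; vector fields are `Fin d → Fld d` and `d × d` matrix fields
are `Fin d → Fin d → Fld d`. -/
abbrev Fld (d : ℕ) : Type := E d → ℝ

/-- The classical partial derivative `∂ⱼ f`. -/
def pd {d : ℕ} (j : Fin d) (f : Fld d) : Fld d :=
  fun x => fderiv ℝ f x (EuclideanSpace.single j 1)

/-- Lebesgue measure on `T`. -/
abbrev vol {d : ℕ} (T : Set (E d)) : Measure (E d) := volume.restrict T

/-- Surface measure: the `(d-1)`-dimensional Hausdorff measure, normalised so as to agree with
Lebesgue measure on hyperplanes, restricted to `S`. -/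
abbrev surf {d : ℕ} (S : Set (E d)) : Measure (E d) :=
  (Measure.euclideanHausdorffMeasure (d - 1) : Measure (E d)).restrict S

/-! ### Polygonal and polyhedral domains -/

/-- `T` has a Lipschitz boundary: near each boundary point, and with respect to a suitable
direction `ν`, `T` is the set of points below the graph of a Lipschitz function `ζ` of the
coordinates orthogonal to `ν`. -/
def HasLipschitzBoundary {d : ℕ} (T : Set (E d)) : Prop :=
  ∀ x ∈ frontier T, ∃ ν : E d, ‖ν‖ = 1 ∧ ∃ r > 0, ∃ (K : NNReal) (ζ : E d → ℝ),
    LipschitzWith K ζ ∧ (∀ y, ∀ t : ℝ, ζ (y + t • ν) = ζ y) ∧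
    ∀ y ∈ Metric.ball x r, y ∈ T ↔ inner ℝ ν y < ζ y

/-- Polygonal (`d = 2`) or polyhedral (`d = 3`) domain: a bounded domain with Lipschitz boundary
which is contained in finitely many hyperplanes. -/
structure IsPolyhedralDomain {d : ℕ} (T : Set (E d)) : Prop where
  isOpen : IsOpen T
  isConnected : IsConnected T
  isBounded : Bornology.IsBounded T
  lipschitz : HasLipschitzBoundary T
  flat : ∃ s : Finset (E d × ℝ), (∀ p ∈ s, p.1 ≠ 0) ∧
    frontier T ⊆ ⋃ p ∈ s, {x | inner ℝ p.1 x = p.2}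

/-- `n` is the outward unit normal of `T` at the flat boundary point `x`: close to `x` the set `T`
is the half space `⟪n, y - x⟫ < 0`. -/
def IsOutwardNormalAt {d : ℕ} (T : Set (E d)) (x n : E d) : Prop :=
  ‖n‖ = 1 ∧ ∀ᶠ y in 𝓝 x, (y ∈ T ↔ inner ℝ n (y - x) < 0)

open Classical in
/-- The outward unit normal field on the boundary of `T` (and `0` at points that are not flat
boundary points; these form a null set in the boundary of a polyhedral domain). -/
def outwardNormal {d : ℕ} (T : Set (E d)) (x : E d) : E d :=
  if h : ∃ n, IsOutwardNormalAt T x n then h.choose else 0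

/-- `e` is an edge / flat face (or a flat part of one) of `T`: a compact subset of the boundary
that lies in a hyperplane and on which the outward unit normal is constant. -/
def IsFlatFace {d : ℕ} (T e : Set (E d)) : Prop :=
  IsCompact e ∧ e ⊆ frontier T ∧ ∃ n : E d, ‖n‖ = 1 ∧ (∃ c : ℝ, ∀ x ∈ e, inner ℝ n x = c) ∧
    ∀ᵐ x ∂(surf e), IsOutwardNormalAt T x n

/-- A finite partition of `Ω` into polygons / polyhedra, with its set of edges / flat faces. The
faces do not overlap, and the boundary of each element is the union of the faces it contains
(hanging nodes are allowed: they split a side into several faces). -/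
structure PolyhedralMesh {d : ℕ} (Ω : Set (E d)) where
  elems : Finset (Set (E d))
  faces : Finset (Set (E d))
  elem_polyhedral : ∀ T ∈ elems, IsPolyhedralDomain T
  elem_subset : ∀ T ∈ elems, T ⊆ Ω
  elem_disjoint : ∀ T ∈ elems, ∀ T' ∈ elems, T ≠ T' → Disjoint T T'
  cover : closure Ω = ⋃ T ∈ elems, closure T
  face_of_elem : ∀ e ∈ faces, ∃ T ∈ elems, e ⊆ frontier T
  face_flat : ∀ T ∈ elems, ∀ e ∈ faces, e ⊆ frontier T → IsFlatFace T e
  face_overlap : ∀ e ∈ faces, ∀ e' ∈ faces, e ≠ e' → surf e e' = 0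
  frontier_eq : ∀ T ∈ elems, frontier T = ⋃ e ∈ {e | e ∈ faces ∧ e ⊆ frontier T}, e

/-- The mesh skeleton: the union of all edges / faces. -/
def PolyhedralMesh.skeleton {d : ℕ} {Ω : Set (E d)} (M : PolyhedralMesh Ω) : Set (E d) :=
  ⋃ e ∈ M.faces, e

/-! ### Sobolev spaces and traces -/

/-- Test functions `C_c^∞(Ω)`. -/
def IsTest {d : ℕ} (Ω : Set (E d)) (φ : Fld d) : Prop :=
  ContDiff ℝ ∞ φ ∧ HasCompactSupport φ ∧ tsupport φ ⊆ Ω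

/-- `v ∈ [H¹(Ω)]ᵈ` with weak gradient `∇v = G`, that is `G i j = ∂ⱼ vᵢ`. -/
structure IsH1 {d : ℕ} (Ω : Set (E d)) (v : Fin d → Fld d) (G : Fin d → Fin d → Fld d) :
    Prop where
  memLp : ∀ i, MemLp (v i) 2 (vol Ω)
  memLp_grad : ∀ i j, MemLp (G i j) 2 (vol Ω)
  weak : ∀ i j, ∀ φ : Fld d, IsTest Ω φ →
    ∫ x in Ω, v i x * pd j φ x = - ∫ x in Ω, G i j x * φ x

/-- `v ∈ H(div, Ω)` with weak divergence `∇ · v = D`. -/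
structure IsHdiv {d : ℕ} (Ω : Set (E d)) (v : Fin d → Fld d) (D : Fld d) : Prop where
  memLp : ∀ i, MemLp (v i) 2 (vol Ω)
  memLp_div : MemLp D 2 (vol Ω)
  weak : ∀ φ : Fld d, IsTest Ω φ →
    ∫ x in Ω, (∑ i, v i x * pd i φ x) = - ∫ x in Ω, D x * φ x

/-- `f m → g` in `L²(μ)`. -/
def TendstoL2 {d : ℕ} (μ : Measure (E d)) (f : ℕ → Fld d) (g : Fld d) : Prop :=
  Tendsto (fun m => eLpNorm (fun x => f m x - g x) 2 μ) atTop (𝓝 0)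

/-- For `v ∈ [H¹(Ω)]ᵈ` with gradient `G`: the field `vb ∈ [L²(S)]ᵈ` is the trace of `v` on the
surface `S`, i.e. the value at `v` of the extension by continuity, from smooth functions to `H¹`,
of the restriction to `S`. -/
def IsTrace {d : ℕ} (Ω S : Set (E d)) (v : Fin d → Fld d) (G : Fin d → Fin d → Fld d)
    (vb : Fin d → Fld d) : Prop :=
  ∀ i, MemLp (vb i) 2 (surf S) ∧ ∃ φ : ℕ → Fld d, (∀ m, ContDiff ℝ ∞ (φ m)) ∧
    TendstoL2 (vol Ω) φ (v i) ∧ (∀ j, TendstoL2 (vol Ω) (fun m => pd j (φ m)) (G i j)) ∧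
    TendstoL2 (surf S) φ (vb i)

/-- For `v ∈ H(div, T)` with divergence `D`: the normal trace `v · n` on `∂T`, defined as the
extension by continuity of `φ ↦ φ · n` from smooth fields to `H(div, T)` with values in the
distributions on `∂T`, is the function `vb · n`. -/
def IsNormalTrace {d : ℕ} (T : Set (E d)) (v : Fin d → Fld d) (D : Fld d)
    (vb : Fin d → Fld d) : Prop :=
  ∃ φ : ℕ → Fin d → Fld d, (∀ m i, ContDiff ℝ ∞ (φ m i)) ∧
    (∀ i, TendstoL2 (vol T) (fun m => φ m i) (v i)) ∧
    TendstoL2 (vol T) (fun m x => ∑ i, pd i (φ m i) x) D ∧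
    ∀ ψ : Fld d, IsTest Set.univ ψ →
      Tendsto (fun m => ∫ x, (∑ i, φ m i x * outwardNormal T x i) * ψ x ∂(surf (frontier T)))
        atTop (𝓝 (∫ x, (∑ i, vb i x * outwardNormal T x i) * ψ x ∂(surf (frontier T))))

/-! ### Polynomials and `L²` projections -/

/-- The function on `ℝᵈ` defined by a polynomial, as a linear map. -/
def evalLin (d : ℕ) : MvPolynomial (Fin d) ℝ →ₗ[ℝ] Fld d where
  toFun p := fun x => MvPolynomial.eval (fun i => x i) p
  map_add' p q := by ext x; simp
  map_smul' c p := by ext x; simp [MvPolynomial.smul_eval]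

/-- Polynomial functions of total degree at most `r`. -/
def Poly (d r : ℕ) : Submodule ℝ (Fld d) :=
  (MvPolynomial.restrictTotalDegree (Fin d) ℝ r).map (evalLin d)

/-- `p` is an `L²(μ)` projection of `f` onto the polynomials of degree at most `r`. -/
def IsL2Proj {d : ℕ} (μ : Measure (E d)) (r : ℕ) (f p : Fld d) : Prop :=
  p ∈ Poly d r ∧ ∀ q ∈ Poly d r, ∫ x, (f x - p x) * q x ∂μ = 0

instance instNonemptyFld (d : ℕ) : Nonempty (Fld d) := ⟨0⟩

/-- The `L²(μ)` projection of `f` onto the polynomials of degree at most `r` (a polynomial that is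
determined `μ`-almost everywhere). -/
def l2Proj {d : ℕ} (μ : Measure (E d)) (r : ℕ) (f : Fld d) : Fld d :=
  Classical.epsilon (IsL2Proj μ r f)

/-- The projection exists. -/
theorem l2Proj_spec {d : ℕ} {μ : Measure (E d)} {r : ℕ} {f : Fld d} (hf : MemLp f 2 μ)
    (hP : ∀ q ∈ Poly d r, MemLp q 2 μ) : IsL2Proj μ r f (l2Proj μ r f) := by
  refine Classical.epsilon_spec (p := IsL2Proj μ r f) ?_
  let L : Poly d r →ₗ[ℝ] Lp ℝ 2 μ :=
    { toFun := fun q => (hP q.1 q.2).toLp q.1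
      map_add' := fun _ _ => rfl
      map_smul' := fun _ _ => rfl }
  have : Module.Finite ℝ (Poly d r) :=
    Module.Finite.map (MvPolynomial.restrictTotalDegree (Fin d) ℝ r) (evalLin d)
  obtain ⟨p, hp⟩ : (L.range.starProjection (hf.toLp f)) ∈ L.range :=
    Submodule.starProjection_apply_mem _ _
  refine ⟨p.1, p.2, fun q hq => ?_⟩
  have h := Submodule.starProjection_inner_eq_zero (K := L.range) (hf.toLp f) (L ⟨q, hq⟩) ⟨_, rfl⟩
  rw [← hp, L2.inner_def] at h
  rw [← h]
  refine integral_congr_ae ?_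
  filter_upwards [Lp.coeFn_sub (hf.toLp f) (L p), hf.coeFn_toLp, (hP p.1 p.2).coeFn_toLp,
    (hP q hq).coeFn_toLp] with x h1 h2 h3 h4
  have h3' : (L p : E d → ℝ) x = p.1 x := h3
  have h4' : (L ⟨q, hq⟩ : E d → ℝ) x = q x := h4
  simp only [h1, Pi.sub_apply, h2, h3', h4', RCLike.inner_apply, conj_trivial]
  ring

/-- `Q₀` on the element `T`: the projection onto `[P_k(T)]ᵈ`. -/
def projElem {d : ℕ} (T : Set (E d)) (k : ℕ) (v : Fin d → Fld d) : Fin d → Fld d :=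
  fun i => l2Proj (vol T) k (v i)

/-- `Q_b`: the projection, on each edge / face `e`, onto `[P_r(e)]ᵈ`, as a field on the skeleton
(faces overlap in null sets only). -/
def PolyhedralMesh.projFaces {d : ℕ} {Ω : Set (E d)} (M : PolyhedralMesh Ω) (r : ℕ)
    (vb : Fin d → Fld d) : Fin d → Fld d :=
  fun i x => ∑ e ∈ M.faces, e.indicator (l2Proj (surf e) r (vb i)) x

/-- The projection onto `[P_r(T)]^{d×d}`. -/
def projMatrix {d : ℕ} (T : Set (E d)) (r : ℕ) (G : Fin d → Fin d → Fld d) :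
    Fin d → Fin d → Fld d :=
  fun i j => l2Proj (vol T) r (G i j)

/-! ### Discrete weak operators -/

/-- `A ∈ [P_r(T)]^{d×d}` is the discrete weak gradient on `T` of the weak function `{v₀, vb}`:
`(A, q)_T = -(v₀, ∇·q)_T + ⟨vb, q·n⟩_{∂T}` for all `q ∈ [P_r(T)]^{d×d}`. -/
def IsDiscreteWeakGradient {d : ℕ} (T : Set (E d)) (r : ℕ) (v₀ vb : Fin d → Fld d)
    (A : Fin d → Fin d → Fld d) : Prop :=
  (∀ i j, A i j ∈ Poly d r) ∧
  ∀ q : Fin d → Fin d → Fld d, (∀ i j, q i j ∈ Poly d r) →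
    ∫ x in T, (∑ i, ∑ j, A i j x * q i j x) =
      - (∫ x in T, ∑ i, v₀ i x * ∑ j, pd j (q i j) x) +
      ∫ x, (∑ i, vb i x * ∑ j, q i j x * outwardNormal T x j) ∂(surf (frontier T))

/-- `p ∈ P_r(T)` is the discrete weak divergence on `T` of the weak function `{v₀, vb}`:
`(p, φ)_T = -(v₀, ∇φ)_T + ⟨vb·n, φ⟩_{∂T}` for all `φ ∈ P_r(T)`. -/
def IsDiscreteWeakDivergence {d : ℕ} (T : Set (E d)) (r : ℕ) (v₀ vb : Fin d → Fld d)
    (p : Fld d) : Prop :=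
  p ∈ Poly d r ∧
  ∀ φ ∈ Poly d r,
    ∫ x in T, p x * φ x =
      - (∫ x in T, ∑ i, v₀ i x * pd i φ x) +
      ∫ x, (∑ i, vb i x * outwardNormal T x i) * φ x ∂(surf (frontier T))

end WG

end

/-!
A polyhedral element `T` has the divergence theorem: up to a null set its indicator is the signed
sum of the indicators of the shadows that its faces cast in a fixed direction, and integrating
`∂_ν f` along the lines of a shadow leaves the integral of `f` over the face. Hence smooth functions
satisfy Green's formula on `T`.

The formula extends to `H¹` by density. Shifting along the direction of the Lipschitz graph before
mollifying, with a partition of unity, approximates an `H¹` function by smooth ones up to the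
boundary. The same directions glue to a smooth field transversal to the boundary, and the divergence
theorem for `|f|²` times this field bounds the `L²` norm of `f` on the boundary by its `H¹` norm, so
the boundary values of the approximations converge to a trace.

For a polynomial `q` of degree at most `r`, Green's formula tests `v` only with `∂ⱼ q`, of degree at
most `k`, and the trace only with the restriction of `q` to faces with constant normal. So `v` and
its trace may be replaced by their projections, and the weak gradient and divergence of `Q_h v` have
the same moments as the projected gradient and divergence of `v`.
-/

noncomputable section

namespace WG

variable {d : ℕ}

/-! ### Hyperplanes and surface measure -/

section Hyperplane

variable {V : Type*} [NormedAddCommGroup V] [InnerProductSpace ℝ V]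

/-- The hyperplane `⟪n, x⟫ = c`. -/
def hyperplane (n : V) (c : ℝ) : Set V := {x | inner ℝ n x = c}

theorem mem_hyperplane {n x : V} {c : ℝ} : x ∈ hyperplane n c ↔ inner ℝ n x = c := Iff.rfl

theorem isClosed_hyperplane (n : V) (c : ℝ) : IsClosed (hyperplane n c) :=
  isClosed_eq (by fun_prop) continuous_const

theorem image_add_right_hyperplane (n v : V) (c : ℝ) :
    (· + v) '' hyperplane n c = hyperplane n (c + inner ℝ n v) := by
  ext x
  simp [mem_hyperplane, inner_sub_right, ← sub_eq_add_neg, sub_eq_iff_eq_add]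

theorem coe_orthogonal_span_singleton (n : V) :
    ((ℝ ∙ n)ᗮ : Set V) = hyperplane n 0 :=
  Set.ext fun _ => Submodule.mem_orthogonal_singleton_iff_inner_right

theorem range_coe_orthogonal_add_smul {n : V} (hn : ‖n‖ = 1) (c : ℝ) :
    Set.range (fun y : (ℝ ∙ n)ᗮ => (y : V) + c • n) = hyperplane n c := by
  calc Set.range (fun y : (ℝ ∙ n)ᗮ => (y : V) + c • n)
      = (· + c • n) '' ((ℝ ∙ n)ᗮ : Set V) := by
        rw [← Subtype.range_coe (s := ((ℝ ∙ n)ᗮ : Set V)), ← Set.range_comp]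
        rfl
    _ = hyperplane n c := by
        rw [coe_orthogonal_span_singleton, image_add_right_hyperplane]
        simp [inner_smul_right, hn]

theorem isometry_coe_add (W : Submodule ℝ V) (v : V) : Isometry (fun y : W => (y : V) + v) :=
  Isometry.of_dist_eq fun x y => by simp [Subtype.dist_eq]

end Hyperplane

theorem surf_hyperplane_eq_map {n : E d} (hn : ‖n‖ = 1) (c : ℝ) :
    surf (hyperplane n c) =
      (volume : Measure (ℝ ∙ n)ᗮ).map (fun y : (ℝ ∙ n)ᗮ => (y : E d) + c • n) := by
  have hn0 : n ≠ 0 := ne_zero_of_norm_ne_zero (by simp [hn])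
  have hrank : Module.finrank ℝ (ℝ ∙ n)ᗮ = d - 1 := by
    have := (ℝ ∙ n).finrank_add_finrank_orthogonal
    rw [finrank_span_singleton hn0, finrank_euclideanSpace_fin] at this
    omega
  rw [← InnerProductSpace.euclideanHausdorffMeasure_eq_volume, hrank,
    (isometry_coe_add _ _).map_euclideanHausdorffMeasure, range_coe_orthogonal_add_smul hn]

theorem sFinite_surf_hyperplane {n : E d} (hn : ‖n‖ = 1) (c : ℝ) :
    SFinite (surf (hyperplane n c)) := by
  rw [surf_hyperplane_eq_map hn]
  infer_instance

theorem isFiniteMeasure_surf_of_subset_hyperplane {n : E d} (hn : ‖n‖ = 1) {c : ℝ} {e : Set (E d)}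
    (he : IsCompact e) (hec : e ⊆ hyperplane n c) : IsFiniteMeasure (surf e) := by
  have h : surf (hyperplane n c) e < ⊤ := by
    rw [surf_hyperplane_eq_map hn, Measure.map_apply (by fun_prop) he.measurableSet]
    exact ((isometry_coe_add _ (c • n)).isClosedEmbedding.isCompact_preimage he).measure_lt_top
  rw [Measure.restrict_apply he.measurableSet, Set.inter_eq_left.2 hec] at h
  exact isFiniteMeasure_restrict.2 h.ne

theorem surf_hyperplane_preimage_add_right (n v : E d) (c : ℝ) {t : Set (E d)}
    (ht : MeasurableSet t) :
    surf (hyperplane n c) ((· + v) ⁻¹' t) = surf (hyperplane n (c + inner ℝ n v)) t := by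
  have hiso : Isometry (· + v : E d → E d) := Isometry.of_dist_eq fun x y => by simp
  rw [Measure.restrict_apply (measurable_add_const v ht), Measure.restrict_apply ht,
    ← hiso.euclideanHausdorffMeasure_image, Set.image_preimage_inter, image_add_right_hyperplane]

theorem volume_eq_lintegral_surf_hyperplane {n : E d} (hn : ‖n‖ = 1) {t : Set (E d)}
    (ht : MeasurableSet t) : volume t = ∫⁻ s : ℝ, surf (hyperplane n s) t := by
  have hplane : ∀ s : ℝ, (AffineSubspace.mk' (s • n +ᵥ (0 : E d)) (ℝ ∙ n)ᗮ : Set (E d)) =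
      hyperplane n s := fun s => by
    ext y
    rw [SetLike.mem_coe, AffineSubspace.mem_mk', Submodule.mem_orthogonal_singleton_iff_inner_right]
    simp [mem_hyperplane, inner_sub_right, inner_smul_right, hn, sub_eq_zero]
  have key := EuclideanGeometry.euclideanHausdorffMeasure_eq_lintegral (P := E d) (0 : E d)
    (ne_zero_of_norm_ne_zero (by simp [hn]) : n ≠ 0) ht
  rw [finrank_euclideanSpace_fin, EuclideanSpace.euclideanHausdorffMeasure_eq_volume] at key
  simpa only [hplane, ← ofReal_norm, hn, ENNReal.ofReal_one, one_mul, Measure.restrict_apply ht]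
    using key

theorem lintegral_eq_mul_lintegral_add_mul (F : ℝ → ENNReal) (c : ℝ) {a : ℝ} (ha : a ≠ 0) :
    ∫⁻ x, F x = ENNReal.ofReal |a| * ∫⁻ s, F (c + a * s) :=
  calc ∫⁻ x, F x = ∫⁻ x, F (c + x) := (lintegral_add_left_eq_self F c).symm
    _ = ENNReal.ofReal |a| * ∫⁻ x, F (c + x) ∂(volume.map (a * ·)) := by
        rw [← smul_eq_mul, ← lintegral_smul_measure, Real.smul_map_volume_mul_left ha]
    _ = ENNReal.ofReal |a| * ∫⁻ s, F (c + a * s) := by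
        congr 1
        exact (Homeomorph.mulLeft₀ a ha).measurableEmbedding.lintegral_map (fun x => F (c + x))

theorem volume_eq_smul_map_surf_hyperplane_prod {n ν : E d} (hn : ‖n‖ = 1) (c : ℝ)
    (ha : inner ℝ n ν ≠ 0) :
    (volume : Measure (E d)) = ENNReal.ofReal |inner ℝ n ν| •
      ((surf (hyperplane n c)).prod volume).map (fun p : E d × ℝ => p.1 + p.2 • ν) := by
  have := sFinite_surf_hyperplane hn c
  have hm : Measurable (fun p : E d × ℝ => p.1 + p.2 • ν) := by fun_prop
  ext t ht
  have hslice : ∀ s : ℝ, surf (hyperplane n c) ((fun y => (y, s)) ⁻¹'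
      ((fun p : E d × ℝ => p.1 + p.2 • ν) ⁻¹' t)) =
      surf (hyperplane n (c + inner ℝ n ν * s)) t := fun s => by
    rw [mul_comm, ← inner_smul_right]
    exact surf_hyperplane_preimage_add_right n (s • ν) c ht
  rw [volume_eq_lintegral_surf_hyperplane hn ht, Measure.smul_apply, Measure.map_apply hm ht,
    Measure.prod_apply_symm (hm ht), lintegral_congr hslice, smul_eq_mul,
    lintegral_eq_mul_lintegral_add_mul _ c ha]

/-! ### Shadows of faces -/

section Shadow

variable {V : Type*} [NormedAddCommGroup V] [InnerProductSpace ℝ V]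

/-- The height of `x` above the hyperplane `⟪n, y⟫ = c`, measured along the transversal
direction `ν`. -/
def height (n ν : V) (c : ℝ) (x : V) : ℝ := (inner ℝ n x - c) / inner ℝ n ν

/-- The oblique projection along `ν` onto the hyperplane `⟪n, y⟫ = c`. -/
def foot (n ν : V) (c : ℝ) (x : V) : V := x - height n ν c x • ν

/-- The shadow cast in direction `ν` by a face `e` of the hyperplane `⟪n, y⟫ = c`, a half-infinite
cylinder. It contains `e` itself exactly when `ν` points to the same side as `n`: with this
convention `indicator_add_sign_mul_shadow_eventually_eq` holds also at parameter `0`. -/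
def shadow (n ν : V) (c : ℝ) (e : Set V) : Set V :=
  {x | foot n ν c x ∈ e ∧ (0 < height n ν c x ∨ 0 < inner ℝ n ν ∧ height n ν c x = 0)}

variable {n ν : V} {c : ℝ}

theorem continuous_height (n ν : V) (c : ℝ) : Continuous (height n ν c) := by
  unfold height
  fun_prop

theorem continuous_foot (n ν : V) (c : ℝ) : Continuous (foot n ν c) :=
  continuous_id.sub ((continuous_height n ν c).smul continuous_const)

theorem height_add_smul (ha : inner ℝ n ν ≠ 0) (x : V) (t : ℝ) :
    height n ν c (x + t • ν) = height n ν c x + t := by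
  simp only [height, inner_add_right, inner_smul_right]
  field_simp
  ring

theorem foot_add_smul (ha : inner ℝ n ν ≠ 0) (x : V) (t : ℝ) :
    foot n ν c (x + t • ν) = foot n ν c x := by
  simp only [foot, height_add_smul ha, add_smul]
  abel

theorem height_of_mem {y : V} (hy : y ∈ hyperplane n c) : height n ν c y = 0 := by
  simp [height, mem_hyperplane.1 hy]

theorem foot_of_mem {y : V} (hy : y ∈ hyperplane n c) : foot n ν c y = y := by
  simp [foot, height_of_mem hy]

theorem add_smul_mem_shadow_iff {e : Set V} (ha : inner ℝ n ν ≠ 0) (hec : e ⊆ hyperplane n c)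
    {y : V} (hy : y ∈ e) (t : ℝ) :
    y + t • ν ∈ shadow n ν c e ↔ 0 < t ∨ 0 < inner ℝ n ν ∧ t = 0 := by
  simp [shadow, foot_add_smul ha, height_add_smul ha, foot_of_mem (hec hy), height_of_mem (hec hy),
    hy]

theorem eventually_add_smul_mem_shadow_iff {e : Set V} (ha : inner ℝ n ν ≠ 0) {y : V}
    (hy : y ∉ e) : ∀ᶠ t in 𝓝 (0 : ℝ), y + t • ν ∈ shadow n ν c e ↔ y ∈ shadow n ν c e := by
  simp only [shadow, Set.mem_ofPred_eq, foot_add_smul ha, height_add_smul ha]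
  by_cases hf : foot n ν c y ∈ e
  · have hne : height n ν c y ≠ 0 := fun h0 => hy (by simpa [foot, h0] using hf)
    have hcont : Tendsto (fun t => height n ν c y + t) (𝓝 0) (𝓝 (height n ν c y)) :=
      Continuous.tendsto' (by fun_prop) _ _ (add_zero _)
    rcases hne.lt_or_gt with hneg | hpos
    · filter_upwards [hcont.eventually_lt_const hneg] with t ht
      simp [hneg.not_gt, hne, ht.not_gt, ht.ne]
    · filter_upwards [hcont.eventually_const_lt hpos] with t ht
      simp [hpos, ht]
  · simp [hf]

theorem eventually_atBot_add_smul_notMem_shadow (ha : inner ℝ n ν ≠ 0) (e : Set V) (x : V) :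
    ∀ᶠ t : ℝ in atBot, x + t • ν ∉ shadow n ν c e := by
  filter_upwards [eventually_lt_atBot (-height n ν c x)] with t ht
  have hlt : height n ν c x + t < 0 := by linarith
  simp [shadow, height_add_smul ha, hlt.not_gt, hlt.ne]

theorem isClosedEmbedding_add_smul (hν : ν ≠ 0) (x : V) :
    IsClosedEmbedding (fun t : ℝ => x + t • ν) :=
  (Homeomorph.addLeft x).isClosedEmbedding.comp (isClosedEmbedding_smul_left hν)

end Shadow

theorem measurableSet_shadow (n ν : E d) (c : ℝ) {e : Set (E d)} (he : MeasurableSet e) :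
    MeasurableSet (shadow n ν c e) := by
  have hheight := (continuous_height n ν c).measurable
  refine ((continuous_foot n ν c).measurable he).inter
    ((measurableSet_lt measurable_const hheight).union ?_)
  exact (MeasurableSet.const _).inter (hheight (measurableSet_singleton 0))

theorem quasiMeasurePreserving_foot {n ν : E d} (hn : ‖n‖ = 1) (c : ℝ) (ha : inner ℝ n ν ≠ 0) :
    Measure.QuasiMeasurePreserving (foot n ν c) volume (surf (hyperplane n c)) := by
  have := sFinite_surf_hyperplane hn c
  refine ⟨(continuous_foot n ν c).measurable, ?_⟩
  have hm : Measurable (fun p : E d × ℝ => p.1 + p.2 • ν) := by fun_prop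
  rw [volume_eq_smul_map_surf_hyperplane_prod hn c ha, Measure.map_smul,
    Measure.map_map (continuous_foot n ν c).measurable hm]
  refine Measure.AbsolutelyContinuous.smul_left ?_ _
  have hfst : (foot n ν c ∘ fun p : E d × ℝ => p.1 + p.2 • ν) =ᵐ[
      (surf (hyperplane n c)).prod (volume : Measure ℝ)] Prod.fst := by
    filter_upwards [Measure.quasiMeasurePreserving_fst.ae
      (ae_restrict_mem (isClosed_hyperplane n c).measurableSet)] with p hp
    simp [foot_add_smul ha, foot_of_mem hp]
  rw [Measure.map_congr hfst]
  exact Measure.quasiMeasurePreserving_fst.absolutelyContinuous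

/-! ### The divergence theorem -/

/-- A decomposition of the boundary of a bounded open set `T` into finitely many flat faces which
overlap in null sets only. The face `e` lies in the hyperplane `⟪normal e, x⟫ = level e`, and
`normal e` is the outward unit normal at almost all of its points. -/
structure FlatBoundary (T : Set (E d)) where
  faces : Finset (Set (E d))
  normal : Set (E d) → E d
  level : Set (E d) → ℝ
  isOpen : IsOpen T
  isBounded : Bornology.IsBounded T
  isCompact : ∀ e ∈ faces, IsCompact e
  norm_normal : ∀ e ∈ faces, ‖normal e‖ = 1
  subset_hyperplane : ∀ e ∈ faces, e ⊆ hyperplane (normal e) (level e)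
  isOutwardNormalAt : ∀ e ∈ faces, ∀ᵐ x ∂(surf e), IsOutwardNormalAt T x (normal e)
  overlap : ∀ e ∈ faces, ∀ e' ∈ faces, e' ≠ e → surf e e' = 0
  frontier_eq : frontier T = ⋃ e ∈ faces, e

theorem PolyhedralMesh.exists_flatBoundary {Ω : Set (E d)} (M : PolyhedralMesh Ω)
    {T : Set (E d)} (hT : T ∈ M.elems) : ∃ B : FlatBoundary T, B.faces ⊆ M.faces := by
  classical
  have hface : ∀ e ∈ M.faces.filter (· ⊆ frontier T), IsFlatFace T e := fun e he =>
    M.face_flat T hT e (Finset.mem_filter.1 he).1 (Finset.mem_filter.1 he).2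
  have hplane : ∀ e, ∃ (n : E d) (c : ℝ), e ∈ M.faces.filter (· ⊆ frontier T) →
      ‖n‖ = 1 ∧ e ⊆ hyperplane n c ∧ ∀ᵐ x ∂(surf e), IsOutwardNormalAt T x n := fun e => by
    by_cases he : e ∈ M.faces.filter (· ⊆ frontier T)
    · obtain ⟨-, -, n, hn, ⟨c, hc⟩, hae⟩ := hface e he
      exact ⟨n, c, fun _ => ⟨hn, hc, hae⟩⟩
    · exact ⟨0, 0, fun h => absurd h he⟩
  choose n c hnc using hplane
  refine ⟨{
    faces := M.faces.filter (· ⊆ frontier T)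
    normal := n
    level := c
    isOpen := (M.elem_polyhedral T hT).isOpen
    isBounded := (M.elem_polyhedral T hT).isBounded
    isCompact := fun e he => (hface e he).1
    norm_normal := fun e he => (hnc e he).1
    subset_hyperplane := fun e he => (hnc e he).2.1
    isOutwardNormalAt := fun e he => (hnc e he).2.2
    overlap := fun e he e' he' hne => M.face_overlap e (Finset.mem_filter.1 he).1 e'
      (Finset.mem_filter.1 he').1 hne.symm
    frontier_eq := by
      conv_lhs => rw [M.frontier_eq T hT]
      simp }, Finset.filter_subset _ _⟩

theorem IsOutwardNormalAt.eventually_add_smul_mem_iff {T : Set (E d)} {y n : E d}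
    (h : IsOutwardNormalAt T y n) (ν : E d) :
    ∀ᶠ t in 𝓝 (0 : ℝ), y + t • ν ∈ T ↔ t * inner ℝ n ν < 0 := by
  have hline : Tendsto (fun t : ℝ => y + t • ν) (𝓝 0) (𝓝 y) :=
    Continuous.tendsto' (by fun_prop) _ _ (by simp)
  filter_upwards [hline.eventually h.2] with t ht
  rw [ht, add_sub_cancel_left, inner_smul_right]

theorem eventually_mem_iff_of_notMem_frontier {X : Type*} [TopologicalSpace X] {s : Set X} {x : X}
    (hx : x ∉ frontier s) : ∀ᶠ y in 𝓝 x, y ∈ s ↔ x ∈ s := by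
  by_cases hxs : x ∈ s
  · have hint : x ∈ interior s := by_contra fun h => hx ⟨subset_closure hxs, h⟩
    filter_upwards [mem_interior_iff_mem_nhds.1 hint] with y hy using iff_of_true hy hxs
  · have hcl : x ∉ closure s := fun h => hx ⟨h, fun hi => hxs (interior_subset hi)⟩
    filter_upwards [isClosed_closure.isOpen_compl.mem_nhds hcl] with y hy
    exact iff_of_false (fun h => hy (subset_closure h)) hxs

theorem indicator_add_sign_mul_shadow_eventually_eq {T e : Set (E d)} {n ν y : E d} {c : ℝ}
    (ha : inner ℝ n ν ≠ 0) (hec : e ⊆ hyperplane n c) (hy : y ∈ e)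
    (hn : IsOutwardNormalAt T y n) :
    ∀ᶠ t in 𝓝 (0 : ℝ),
      T.indicator 1 (y + t • ν) +
          (SignType.sign (inner ℝ n ν) : ℝ) * (shadow n ν c e).indicator 1 (y + t • ν) =
        T.indicator 1 y + (SignType.sign (inner ℝ n ν) : ℝ) * (shadow n ν c e).indicator 1 y := by
  classical
  have hconst : ∀ᶠ t in 𝓝 (0 : ℝ), T.indicator 1 (y + t • ν) +
      (SignType.sign (inner ℝ n ν) : ℝ) * (shadow n ν c e).indicator 1 (y + t • ν) =
      if 0 < inner ℝ n ν then 1 else 0 := by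
    filter_upwards [hn.eventually_add_smul_mem_iff ν] with t ht
    simp only [Set.indicator_apply, ht, add_smul_mem_shadow_iff ha hec hy, Pi.one_apply]
    rcases ha.lt_or_gt with hneg | hpos
    · have : t * inner ℝ n ν < 0 ↔ 0 < t := by
        simp [mul_neg_iff, hneg, hneg.not_gt]
      by_cases h : 0 < t <;> simp [this, hneg, hneg.not_gt, h]
    · have : t * inner ℝ n ν < 0 ↔ t < 0 := by
        simp [mul_neg_iff, hpos, hpos.not_gt]
      rcases lt_trichotomy t 0 with h | h | h
      · simp [this, hpos, h, h.not_gt, h.ne]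
      · simp [hpos, h]
      · simp [this, hpos, h, h.not_gt]
  have hzero := hconst.self_of_nhds
  rw [zero_smul, add_zero] at hzero
  filter_upwards [hconst] with t ht
  rw [ht, hzero]

namespace FlatBoundary

variable {T : Set (E d)} (B : FlatBoundary T)

/-- A point that is no corner of `T`: it lies on at most one face, and if it lies on one then the
normal of that face is the outward normal there. -/
def IsRegularAt (y : E d) : Prop :=
  ∀ e ∈ B.faces, y ∈ e →
    IsOutwardNormalAt T y (B.normal e) ∧ ∀ e' ∈ B.faces, e' ≠ e → y ∉ e'

/-- The error in writing `1_T` as a signed sum of shadows of faces: in the direction `ν`, one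
enters `T` through the faces with `⟪normal e, ν⟫ < 0` and leaves it through those with
`⟪normal e, ν⟫ > 0`. It is zero almost everywhere. -/
def shadowDefect (ν x : E d) : ℝ :=
  T.indicator 1 x + ∑ e ∈ B.faces, (SignType.sign (inner ℝ (B.normal e) ν) : ℝ) *
    (shadow (B.normal e) ν (B.level e) e).indicator 1 x

variable {B} {ν : E d}

theorem ae_forall_isRegularAt_add_smul (ha : ∀ e ∈ B.faces, inner ℝ (B.normal e) ν ≠ 0) :
    ∀ᵐ x : E d, ∀ t : ℝ, B.IsRegularAt (x + t • ν) := by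
  have hfoot : ∀ᵐ x : E d, ∀ e ∈ B.faces, foot (B.normal e) ν (B.level e) x ∈ e →
      B.IsRegularAt (foot (B.normal e) ν (B.level e) x) := by
    rw [Filter.eventually_all_finset]
    intro e he
    refine (quasiMeasurePreserving_foot (B.norm_normal e he) (B.level e) (ha e he)).ae
      (p := fun y => y ∈ e → B.IsRegularAt y) (ae_restrict_of_ae ?_)
    rw [← ae_restrict_iff' (B.isCompact e he).measurableSet]
    have hdisjoint : ∀ᵐ y ∂(surf e), ∀ e' ∈ B.faces, e' ≠ e → y ∉ e' := by
      simp only [Filter.eventually_all_finset, Filter.eventually_imp_distrib_left]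
      exact fun e' he' hne => measure_eq_zero_iff_ae_notMem.1 (B.overlap e he e' he' hne)
    filter_upwards [B.isOutwardNormalAt e he, hdisjoint, ae_restrict_mem
      (B.isCompact e he).measurableSet] with y hnormal hother hye e' he' hye'
    obtain rfl : e' = e := by_contra fun hne => hother e' he' hne hye'
    exact ⟨hnormal, hother⟩
  filter_upwards [hfoot] with x hx t e he hmem
  have heq : foot (B.normal e) ν (B.level e) x = x + t • ν := by
    rw [← foot_add_smul (ha e he) x t, foot_of_mem (B.subset_hyperplane e he hmem)]
  exact (heq ▸ hx e he (heq ▸ hmem) : B.IsRegularAt (x + t • ν)) e he hmem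

theorem subset_frontier {e : Set (E d)} (he : e ∈ B.faces) : e ⊆ frontier T :=
  B.frontier_eq ▸ Set.subset_biUnion_of_mem (u := fun e => e) he

theorem IsRegularAt.eventually_shadowDefect_add_smul_eq {y : E d} (hy : B.IsRegularAt y)
    (ha : ∀ e ∈ B.faces, inner ℝ (B.normal e) ν ≠ 0) :
    ∀ᶠ t in 𝓝 (0 : ℝ), B.shadowDefect ν (y + t • ν) = B.shadowDefect ν y := by
  classical
  have hother : ∀ᶠ t in 𝓝 (0 : ℝ), ∀ e ∈ B.faces, y ∉ e →
      (shadow (B.normal e) ν (B.level e) e).indicator (1 : E d → ℝ) (y + t • ν) =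
        (shadow (B.normal e) ν (B.level e) e).indicator 1 y := by
    simp only [Filter.eventually_all_finset, Filter.eventually_imp_distrib_left]
    intro e he hye
    filter_upwards [eventually_add_smul_mem_shadow_iff (c := B.level e) (ha e he) hye] with t ht
    simp only [Set.indicator_apply, ht, Pi.one_apply]
  by_cases hface : ∃ e ∈ B.faces, y ∈ e
  · obtain ⟨e, he, hye⟩ := hface
    obtain ⟨hnormal, hunique⟩ := hy e he hye
    filter_upwards [hother, indicator_add_sign_mul_shadow_eventually_eq (ha e he)
      (B.subset_hyperplane e he) hye hnormal] with t hrest hjump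
    rw [shadowDefect, shadowDefect, ← Finset.add_sum_erase _ _ he, ← Finset.add_sum_erase _ _ he,
      ← add_assoc, ← add_assoc, hjump]
    congr 1
    refine Finset.sum_congr rfl fun e' he' => ?_
    obtain ⟨hne, he'⟩ := Finset.mem_erase.1 he'
    rw [hrest e' he' (hunique e' he' hne)]
  · push Not at hface
    have hfrontier : y ∉ frontier T := by simpa [B.frontier_eq] using hface
    have hline : Tendsto (fun t : ℝ => y + t • ν) (𝓝 0) (𝓝 y) :=
      Continuous.tendsto' (by fun_prop) _ _ (by simp)
    filter_upwards [hother,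
      hline.eventually (eventually_mem_iff_of_notMem_frontier hfrontier)] with t hrest hT
    simp only [shadowDefect, Set.indicator_apply T, hT, Pi.one_apply]
    congr 1
    exact Finset.sum_congr rfl fun e he => by rw [hrest e he (hface e he)]

theorem eventually_atBot_shadowDefect_add_smul_eq_zero (hν : ν ≠ 0)
    (ha : ∀ e ∈ B.faces, inner ℝ (B.normal e) ν ≠ 0) (x : E d) :
    ∀ᶠ t : ℝ in atBot, B.shadowDefect ν (x + t • ν) = 0 := by
  have hshadow : ∀ᶠ t : ℝ in atBot, ∀ e ∈ B.faces,
      x + t • ν ∉ shadow (B.normal e) ν (B.level e) e := by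
    rw [Filter.eventually_all_finset]
    exact fun e he => eventually_atBot_add_smul_notMem_shadow (ha e he) e x
  obtain ⟨m, hm⟩ := ((isClosedEmbedding_add_smul hν x).isCompact_preimage
    B.isBounded.isCompact_closure).bddBelow
  filter_upwards [hshadow, eventually_lt_atBot m] with t ht htm
  have hT : x + t • ν ∉ T := fun h => htm.not_ge (hm (subset_closure h))
  rw [shadowDefect, Set.indicator_of_notMem hT, zero_add]
  exact Finset.sum_eq_zero fun e he => by rw [Set.indicator_of_notMem (ht e he), mul_zero]

theorem shadowDefect_ae_eq_zero (hν : ν ≠ 0) (ha : ∀ e ∈ B.faces, inner ℝ (B.normal e) ν ≠ 0) :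
    B.shadowDefect ν =ᵐ[volume] 0 := by
  filter_upwards [ae_forall_isRegularAt_add_smul ha] with x hx
  have hconst : IsLocallyConstant fun t : ℝ => B.shadowDefect ν (x + t • ν) := by
    rw [IsLocallyConstant.iff_eventually_eq]
    intro t
    have hsub : Tendsto (fun s : ℝ => s - t) (𝓝 t) (𝓝 0) :=
      Continuous.tendsto' (by fun_prop) _ _ (sub_self t)
    filter_upwards [hsub.eventually ((hx t).eventually_shadowDefect_add_smul_eq ha)] with s hs
    rw [← hs, add_assoc, ← add_smul, add_sub_cancel]
  obtain ⟨t, ht⟩ := (eventually_atBot_shadowDefect_add_smul_eq_zero hν ha x).exists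
  simpa using (hconst.apply_eq_of_preconnectedSpace 0 t).trans ht

end FlatBoundary

theorem integral_Ioi_fderiv_add_smul {V : Type*} [NormedAddCommGroup V] [InnerProductSpace ℝ V]
    {f : V → ℝ} (hf : ContDiff ℝ 1 f) (hfc : HasCompactSupport f) {ν : V} (hν : ν ≠ 0) (y : V) :
    ∫ t in Set.Ioi (0 : ℝ), fderiv ℝ f (y + t • ν) ν = -f y := by
  have hderiv : ∀ t : ℝ, deriv (fun t : ℝ => f (y + t • ν)) t = fderiv ℝ f (y + t • ν) ν := by
    intro t
    have hline : HasDerivAt (fun t : ℝ => y + t • ν) ν t := by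
      simpa using ((hasDerivAt_id t).smul_const ν).const_add y
    exact ((hf.differentiable one_ne_zero _).hasFDerivAt.comp_hasDerivAt t hline).deriv
  have key := (hfc.comp_isClosedEmbedding (isClosedEmbedding_add_smul hν y)).integral_Ioi_deriv_eq
    (hf.comp (by fun_prop)) 0
  simpa [Function.comp_def, hderiv] using key

theorem integrable_fderiv_apply {V : Type*} [NormedAddCommGroup V] [NormedSpace ℝ V]
    [MeasurableSpace V] [OpensMeasurableSpace V] {μ : Measure V} [IsFiniteMeasureOnCompacts μ]
    {f : V → ℝ} (hf : ContDiff ℝ 1 f) (hfc : HasCompactSupport f) (ν : V) :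
    Integrable (fun x => fderiv ℝ f x ν) μ := by
  refine Continuous.integrable_of_hasCompactSupport ?_ ?_
  · exact (hf.continuous_fderiv one_ne_zero).clm_apply continuous_const
  · exact (hfc.fderiv ℝ).comp_left (g := fun L : V →L[ℝ] ℝ => L ν) (by simp)

theorem integral_eq_abs_mul_integral_surf_hyperplane {n ν : E d} (hn : ‖n‖ = 1) (c : ℝ)
    (ha : inner ℝ n ν ≠ 0) {g : E d → ℝ} (hg : Integrable g) :
    ∫ x, g x = |inner ℝ n ν| * ∫ y, (∫ t : ℝ, g (y + t • ν)) ∂(surf (hyperplane n c)) := by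
  have := sFinite_surf_hyperplane hn c
  have hm : Measurable (fun p : E d × ℝ => p.1 + p.2 • ν) := by fun_prop
  have hvol := volume_eq_smul_map_surf_hyperplane_prod hn c ha
  have hmap : Integrable g (((surf (hyperplane n c)).prod volume).map
      (fun p : E d × ℝ => p.1 + p.2 • ν)) := by
    rw [hvol] at hg
    exact (integrable_smul_measure (by simpa using ha) ENNReal.ofReal_ne_top).1 hg
  conv_lhs => rw [hvol]
  rw [integral_smul_measure, ENNReal.toReal_ofReal (abs_nonneg _), smul_eq_mul,
    integral_map hm.aemeasurable hmap.aestronglyMeasurable,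
    integral_prod (fun p : E d × ℝ => g (p.1 + p.2 • ν)) (hmap.comp_measurable hm)]

theorem setIntegral_shadow_fderiv {f : Fld d} (hf : ContDiff ℝ 1 f) (hfc : HasCompactSupport f)
    {n ν : E d} {c : ℝ} (hn : ‖n‖ = 1) (ha : inner ℝ n ν ≠ 0) {e : Set (E d)}
    (he : MeasurableSet e) (hec : e ⊆ hyperplane n c) :
    ∫ x in shadow n ν c e, fderiv ℝ f x ν = -(|inner ℝ n ν| * ∫ x, f x ∂(surf e)) := by
  have hν : ν ≠ 0 := fun h => ha (by rw [h, inner_zero_right])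
  have hmeas := measurableSet_shadow n ν c he
  have hfiber : ∀ y ∈ hyperplane n c,
      ∫ t : ℝ, (shadow n ν c e).indicator (fun x => fderiv ℝ f x ν) (y + t • ν) =
        e.indicator (fun y => -f y) y := fun y hy => by
    by_cases hye : y ∈ e
    · rw [Set.indicator_of_mem hye, ← integral_Ioi_fderiv_add_smul hf hfc hν y,
        ← integral_indicator measurableSet_Ioi]
      refine integral_congr_ae ?_
      filter_upwards [Measure.ae_ne volume (0 : ℝ)] with t ht
      by_cases h0 : 0 < t <;> simp [Set.indicator, add_smul_mem_shadow_iff ha hec hye, h0, ht]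
    · have hout : ∀ t : ℝ, y + t • ν ∉ shadow n ν c e := fun t h =>
        hye (by simpa [foot_add_smul ha, foot_of_mem hy] using h.1)
      simp [hye, hout]
  rw [← integral_indicator hmeas, integral_eq_abs_mul_integral_surf_hyperplane hn c ha
    ((integrable_fderiv_apply hf hfc ν).indicator hmeas),
    setIntegral_congr_fun (isClosed_hyperplane n c).measurableSet hfiber, integral_indicator he,
    Measure.restrict_restrict he, Set.inter_eq_left.2 hec, integral_neg, mul_neg]

theorem linearMap_eq_zero_of_forall_inner_ne_zero {V : Type*} [NormedAddCommGroup V]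
    [InnerProductSpace ℝ V] {s : Finset V} (hs : 0 ∉ s) {L : V →ₗ[ℝ] ℝ}
    (hL : ∀ u, (∀ n ∈ s, inner ℝ n u ≠ 0) → L u = 0) : L = 0 := by
  classical
  by_contra hL0
  have htop : ⊤ ∉ insert (LinearMap.ker L) (s.image fun n => LinearMap.ker (innerₗ V n)) := by
    simp only [Finset.mem_insert, Finset.mem_image, not_or, not_exists, not_and]
    refine ⟨fun h => hL0 (LinearMap.ker_eq_top.1 h.symm), fun n hn h => ?_⟩
    have hself : innerₗ V n n = 0 := by rw [LinearMap.ker_eq_top.1 h, LinearMap.zero_apply]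
    exact hs (inner_self_eq_zero.1 hself ▸ hn)
  obtain ⟨u, hu⟩ := (Set.ne_univ_iff_exists_notMem _).1
    (Subspace.biUnion_ne_univ_of_top_notMem htop)
  simp only [Set.mem_iUnion, not_exists] at hu
  exact hu _ (Finset.mem_insert_self _ _) (hL u fun n hn h =>
    hu _ (Finset.mem_insert_of_mem (Finset.mem_image_of_mem _ hn)) h)

namespace FlatBoundary

variable {T : Set (E d)} (B : FlatBoundary T)

theorem setIntegral_fderiv_of_forall_inner_ne_zero {f : Fld d} (hf : ContDiff ℝ 1 f)
    (hfc : HasCompactSupport f) {ν : E d} (hν : ν ≠ 0)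
    (ha : ∀ e ∈ B.faces, inner ℝ (B.normal e) ν ≠ 0) :
    ∫ x in T, fderiv ℝ f x ν =
      ∑ e ∈ B.faces, inner ℝ (B.normal e) ν * ∫ x, f x ∂(surf e) := by
  set S := fun e => shadow (B.normal e) ν (B.level e) e
  have hmeas : ∀ e ∈ B.faces, MeasurableSet (S e) := fun e he =>
    measurableSet_shadow _ _ _ (B.isCompact e he).measurableSet
  have hsum : T.indicator (fun x => fderiv ℝ f x ν) =ᵐ[volume] fun x => ∑ e ∈ B.faces,
      -(SignType.sign (inner ℝ (B.normal e) ν) : ℝ) *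
        (S e).indicator (fun x => fderiv ℝ f x ν) x := by
    filter_upwards [shadowDefect_ae_eq_zero hν ha] with x hx
    have hfactor : ∀ A : Set (E d), A.indicator (fun x => fderiv ℝ f x ν) x =
        A.indicator 1 x * fderiv ℝ f x ν := fun A => by
      by_cases h : x ∈ A <;> simp [h]
    simp only [hfactor, neg_mul, ← mul_assoc, Finset.sum_neg_distrib, ← Finset.sum_mul]
    rw [eq_neg_of_add_eq_zero_left hx, neg_mul]
  have hint : Integrable (fun x => fderiv ℝ f x ν) := integrable_fderiv_apply hf hfc ν
  rw [← integral_indicator B.isOpen.measurableSet, integral_congr_ae hsum,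
    integral_finsetSum _ fun e he => (hint.indicator (hmeas e he)).const_mul _]
  refine Finset.sum_congr rfl fun e he => ?_
  rw [integral_const_mul, integral_indicator (hmeas e he), setIntegral_shadow_fderiv hf hfc
    (B.norm_normal e he) (ha e he) (B.isCompact e he).measurableSet (B.subset_hyperplane e he)]
  conv_rhs => rw [← sign_mul_abs (inner ℝ (B.normal e) ν : ℝ)]
  ring

theorem setIntegral_fderiv_of_hasCompactSupport {f : Fld d} (hf : ContDiff ℝ 1 f)
    (hfc : HasCompactSupport f) (ν : E d) :
    ∫ x in T, fderiv ℝ f x ν =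
      ∑ e ∈ B.faces, inner ℝ (B.normal e) ν * ∫ x, f x ∂(surf e) := by
  classical
  have hint := fun ν => integrable_fderiv_apply (μ := vol T) hf hfc ν
  let L : E d →ₗ[ℝ] ℝ :=
    { toFun := fun ν => (∫ x in T, fderiv ℝ f x ν) -
        ∑ e ∈ B.faces, inner ℝ (B.normal e) ν * ∫ x, f x ∂(surf e)
      map_add' := fun u v => by
        simp only [map_add, inner_add_right, add_mul, Finset.sum_add_distrib]
        rw [integral_add (hint u) (hint v)]
        ring
      map_smul' := fun t u => by
        simp only [map_smul, inner_smul_right, smul_eq_mul, mul_assoc, ← Finset.mul_sum,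
          RingHom.id_apply, integral_const_mul]
        ring }
  have hL : L = 0 := by
    refine linearMap_eq_zero_of_forall_inner_ne_zero (s := B.faces.image B.normal) ?_ fun u hu => ?_
    · simp only [Finset.mem_image, not_exists, not_and]
      exact fun e he h => by simpa [h] using B.norm_normal e he
    · rcases eq_or_ne u 0 with rfl | hu0
      · exact map_zero L
      · exact sub_eq_zero.2 (B.setIntegral_fderiv_of_forall_inner_ne_zero hf hfc hu0
          fun e he => hu _ (Finset.mem_image_of_mem _ he))
  exact sub_eq_zero.1 (LinearMap.congr_fun hL ν)

end FlatBoundary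

theorem IsOutwardNormalAt.inner_neg_iff {T : Set (E d)} {x n n' : E d}
    (h : IsOutwardNormalAt T x n) (h' : IsOutwardNormalAt T x n') (v : E d) :
    inner ℝ n v < 0 ↔ inner ℝ n' v < 0 := by
  obtain ⟨t, ⟨hn, hn'⟩, ht⟩ := (((h.eventually_add_smul_mem_iff v).and
    (h'.eventually_add_smul_mem_iff v)).filter_mono nhdsWithin_le_nhds |>.and
      (self_mem_nhdsWithin (s := Set.Ioi (0 : ℝ)))).exists
  have hpos : 0 < t := ht
  rw [← smul_neg_iff_of_pos_left hpos, ← smul_neg_iff_of_pos_left (b := inner ℝ n' v) hpos,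
    smul_eq_mul, smul_eq_mul, ← hn, hn']

theorem IsOutwardNormalAt.unique {T : Set (E d)} {x n n' : E d}
    (h : IsOutwardNormalAt T x n) (h' : IsOutwardNormalAt T x n') : n = n' := by
  by_contra hne
  have hlt : inner ℝ n n' < 1 := (inner_lt_one_iff_real_of_norm_eq_one h.1 h'.1).2 hne
  have hneg : inner ℝ n (n' - n) < 0 := by
    rw [inner_sub_right, real_inner_self_eq_norm_sq, h.1]
    linarith
  have hneg' := (h.inner_neg_iff h' _).1 hneg
  rw [inner_sub_right, real_inner_self_eq_norm_sq, h'.1, real_inner_comm] at hneg'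
  linarith

theorem IsOutwardNormalAt.outwardNormal_eq {T : Set (E d)} {x n : E d}
    (h : IsOutwardNormalAt T x n) : outwardNormal T x = n := by
  have hex : ∃ n, IsOutwardNormalAt T x n := ⟨n, h⟩
  rw [outwardNormal, dif_pos hex]
  exact hex.choose_spec.unique h

theorem exists_hasCompactSupport_eventuallyEq {V : Type*} [NormedAddCommGroup V]
    [NormedSpace ℝ V] [HasContDiffBump V] [FiniteDimensional ℝ V] {s : Set V}
    (hs : Bornology.IsBounded s) {n : ℕ∞} {f : V → ℝ} (hf : ContDiff ℝ n f) :
    ∃ g : V → ℝ, ContDiff ℝ n g ∧ HasCompactSupport g ∧ ∀ x ∈ closure s, g =ᶠ[𝓝 x] f := by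
  obtain ⟨R, hR0, hR⟩ := hs.closure.subset_ball_lt 0 0
  let χ : ContDiffBump (0 : V) := ⟨R, R + 1, hR0, by linarith⟩
  refine ⟨fun y => χ y * f y, χ.contDiff.mul hf, χ.hasCompactSupport.mul_right, fun x hx => ?_⟩
  filter_upwards [χ.eventuallyEq_one_of_mem_ball (hR hx)] with y hy
  rw [hy, Pi.one_apply, one_mul]

theorem integrable_of_continuous_of_isBounded {V : Type*} [MetricSpace V] [ProperSpace V]
    [MeasurableSpace V] [OpensMeasurableSpace V] {μ : Measure V} [IsFiniteMeasureOnCompacts μ]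
    {s : Set V} (hs : Bornology.IsBounded s) {f : V → ℝ} (hf : Continuous f) :
    IntegrableOn f s μ :=
  (hf.continuousOn.integrableOn_compact hs.isCompact_closure).mono_set subset_closure

theorem memLp_of_continuous_of_isCompact {V : Type*} [TopologicalSpace V] [T2Space V]
    [MeasurableSpace V] [BorelSpace V] {μ : Measure V} {s : Set V} (hs : IsCompact s)
    [IsFiniteMeasure (μ.restrict s)] {f : V → ℝ} (hf : Continuous f) (p : ENNReal) :
    MemLp f p (μ.restrict s) := by
  obtain ⟨C, hC⟩ := hs.exists_bound_of_continuousOn hf.continuousOn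
  exact MemLp.of_bound hf.aestronglyMeasurable C (ae_restrict_of_forall_mem hs.measurableSet hC)

theorem memLp_of_continuous_of_isBounded {V : Type*} [MetricSpace V] [ProperSpace V]
    [MeasurableSpace V] [BorelSpace V] {μ : Measure V} [IsFiniteMeasureOnCompacts μ]
    {s : Set V} (hs : Bornology.IsBounded s) {f : V → ℝ} (hf : Continuous f) (p : ENNReal) :
    MemLp f p (μ.restrict s) :=
  have : IsFiniteMeasure (μ.restrict (closure s)) :=
    ⟨by simpa using hs.isCompact_closure.measure_lt_top⟩
  (memLp_of_continuous_of_isCompact hs.isCompact_closure hf p).mono_measure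
    (Measure.restrict_mono subset_closure le_rfl)

namespace FlatBoundary

variable {T : Set (E d)}

theorem isFiniteMeasure_surf (B : FlatBoundary T) {e : Set (E d)} (he : e ∈ B.faces) :
    IsFiniteMeasure (surf e) :=
  isFiniteMeasure_surf_of_subset_hyperplane (B.norm_normal e he) (B.isCompact e he)
    (B.subset_hyperplane e he)

theorem surf_frontier (B : FlatBoundary T) : surf (frontier T) = ∑ e ∈ B.faces, surf e := by
  have hunion : frontier T = ⋃ e : B.faces, (e : Set (E d)) := by
    rw [B.frontier_eq, Set.iUnion_subtype]
  rw [hunion, surf, Measure.restrict_iUnion_ae, Measure.sum_fintype,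
    Finset.sum_coe_sort B.faces surf]
  · intro e e' hne
    have hnull := B.overlap e e.2 e' e'.2 fun heq => hne (Subtype.ext heq.symm)
    rwa [Measure.restrict_apply (B.isCompact _ e'.2).measurableSet, Set.inter_comm] at hnull
  · exact fun e => (B.isCompact e e.2).measurableSet.nullMeasurableSet

theorem isFiniteMeasure_surf_frontier (B : FlatBoundary T) :
    IsFiniteMeasure (surf (frontier T)) := by
  refine ⟨?_⟩
  rw [B.surf_frontier, Measure.finsetSum_apply]
  refine ENNReal.sum_lt_top.2 fun e he => ?_
  have := B.isFiniteMeasure_surf he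
  exact measure_lt_top _ _

theorem ae_surf_frontier_iff (B : FlatBoundary T) {p : E d → Prop} :
    (∀ᵐ x ∂(surf (frontier T)), p x) ↔ ∀ e ∈ B.faces, ∀ᵐ x ∂(surf e), p x := by
  simp only [B.surf_frontier, ae_iff, Measure.finsetSum_apply, Finset.sum_eq_zero_iff]

theorem ae_outwardNormal_eq (B : FlatBoundary T) {e : Set (E d)} (he : e ∈ B.faces) :
    ∀ᵐ x ∂(surf e), outwardNormal T x = B.normal e := by
  filter_upwards [B.isOutwardNormalAt e he] with x hx using hx.outwardNormal_eq

theorem ae_isOutwardNormalAt (B : FlatBoundary T) :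
    ∀ᵐ x ∂(surf (frontier T)), IsOutwardNormalAt T x (outwardNormal T x) := by
  rw [B.ae_surf_frontier_iff]
  intro e he
  filter_upwards [B.isOutwardNormalAt e he] with x hx
  rwa [hx.outwardNormal_eq]

theorem memLp_surf_frontier_of_continuous (B : FlatBoundary T) {f : Fld d} (hf : Continuous f)
    (p : ENNReal) : MemLp f p (surf (frontier T)) :=
  have := B.isFiniteMeasure_surf_frontier
  memLp_of_continuous_of_isCompact (Metric.isCompact_of_isClosed_isBounded isClosed_frontier
    (B.isBounded.closure.subset frontier_subset_closure)) hf p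

theorem memLp_mul_outwardNormal (B : FlatBoundary T) {f : Fld d} {p : ENNReal}
    (hf : MemLp f p (surf (frontier T))) (j : Fin d) :
    MemLp (fun x => f x * outwardNormal T x j) p (surf (frontier T)) := by
  have hmeas : AEStronglyMeasurable (fun x => outwardNormal T x j) (surf (frontier T)) := by
    rw [B.surf_frontier, ← Finset.sum_coe_sort, ← Measure.sum_fintype,
      aestronglyMeasurable_sum_measure_iff]
    rintro ⟨e, he⟩
    refine aestronglyMeasurable_const.congr (?_ : (fun _ => B.normal e j) =ᵐ[surf e] _)
    filter_upwards [B.ae_outwardNormal_eq he] with x hx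
    rw [hx]
  refine hf.of_le (hf.1.mul hmeas) ?_
  filter_upwards [B.ae_isOutwardNormalAt] with x hx
  rw [norm_mul]
  exact mul_le_of_le_one_right (norm_nonneg _) ((PiLp.norm_apply_le _ j).trans hx.1.le)

theorem integral_mul_outwardNormal (B : FlatBoundary T) {f : Fld d}
    (hf : Integrable f (surf (frontier T))) (j : Fin d) :
    ∫ x, f x * outwardNormal T x j ∂(surf (frontier T)) =
      ∑ e ∈ B.faces, B.normal e j * ∫ x, f x ∂(surf e) := by
  have hint := memLp_one_iff_integrable.1
    (B.memLp_mul_outwardNormal (memLp_one_iff_integrable.2 hf) j)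
  rw [B.surf_frontier] at hint ⊢
  rw [integral_finsetSum_measure (integrable_finsetSum_measure.1 hint)]
  refine Finset.sum_congr rfl fun e he => ?_
  rw [← integral_const_mul]
  refine integral_congr_ae ?_
  filter_upwards [B.ae_outwardNormal_eq he] with x hx
  rw [hx, mul_comm]

theorem setIntegral_pd (B : FlatBoundary T) {f : Fld d} (hf : ContDiff ℝ 1 f) (j : Fin d) :
    ∫ x in T, pd j f x = ∫ x, f x * outwardNormal T x j ∂(surf (frontier T)) := by
  obtain ⟨g, hg, hgc, hgf⟩ := exists_hasCompactSupport_eventuallyEq B.isBounded hf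
  calc ∫ x in T, pd j f x
      = ∫ x in T, pd j g x :=
        setIntegral_congr_fun B.isOpen.measurableSet fun x hx => by
          simp only [pd, (hgf x (subset_closure hx)).fderiv_eq]
    _ = ∑ e ∈ B.faces, B.normal e j * ∫ x, g x ∂(surf e) := by
        simpa [pd, EuclideanSpace.inner_single_right] using
          B.setIntegral_fderiv_of_hasCompactSupport hg hgc (EuclideanSpace.single j 1)
    _ = ∑ e ∈ B.faces, B.normal e j * ∫ x, f x ∂(surf e) :=
        Finset.sum_congr rfl fun e he => by
          rw [setIntegral_congr_fun (B.isCompact e he).measurableSet fun x hx =>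
            (hgf x (frontier_subset_closure (subset_frontier he hx))).self_of_nhds]
    _ = ∫ x, f x * outwardNormal T x j ∂(surf (frontier T)) :=
        (B.integral_mul_outwardNormal (memLp_one_iff_integrable.1
          (B.memLp_surf_frontier_of_continuous hf.continuous 1)) j).symm

end FlatBoundary

theorem continuous_pd {n : WithTop ℕ∞} {f : Fld d} (hf : ContDiff ℝ n f) (hn : n ≠ 0)
    (j : Fin d) : Continuous (pd j f) :=
  (hf.continuous_fderiv hn).clm_apply continuous_const

theorem pd_mul {f g : Fld d} {x : E d} (hf : DifferentiableAt ℝ f x)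
    (hg : DifferentiableAt ℝ g x) (j : Fin d) :
    pd j (fun y => f y * g y) x = pd j f x * g x + f x * pd j g x := by
  simp only [pd, fderiv_fun_mul hf hg, add_apply, smul_apply,
    smul_eq_mul]
  ring

theorem FlatBoundary.setIntegral_pd_mul {T : Set (E d)} (B : FlatBoundary T) {f q : Fld d}
    (hf : ContDiff ℝ 1 f) (hq : ContDiff ℝ 1 q) (j : Fin d) :
    ∫ x in T, pd j f x * q x = -(∫ x in T, f x * pd j q x) +
      ∫ x, f x * q x * outwardNormal T x j ∂(surf (frontier T)) := by
  have hleft : Integrable (fun x => f x * pd j q x) (vol T) :=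
    integrable_of_continuous_of_isBounded B.isBounded
      (hf.continuous.mul (continuous_pd hq one_ne_zero j))
  have hright : Integrable (fun x => pd j f x * q x) (vol T) :=
    integrable_of_continuous_of_isBounded B.isBounded
      ((continuous_pd hf one_ne_zero j).mul hq.continuous)
  rw [← B.setIntegral_pd (hf.mul hq) j, eq_neg_add_iff_add_eq, ← integral_add hleft hright]
  refine integral_congr_ae (Eventually.of_forall fun x => ?_)
  simp only [pd_mul (hf.differentiable one_ne_zero x) (hq.differentiable one_ne_zero x) j]
  ring

/-! ### The trace inequality -/

theorem exists_smooth_partition {V : Type*} [NormedAddCommGroup V] [NormedSpace ℝ V]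
    [FiniteDimensional ℝ V] {K : Set V} (hK : IsCompact K) {r : V → ℝ} (hr : ∀ x ∈ K, 0 < r x) :
    ∃ (t : Finset V) (χ : V → V → ℝ), (∀ x ∈ t, x ∈ K) ∧
      (∀ x ∈ t, ContDiff ℝ ∞ (χ x) ∧ (∀ y, 0 ≤ χ x y) ∧ tsupport (χ x) ⊆ Metric.ball x (r x)) ∧
      ∀ y ∈ K, ∑ x ∈ t, χ x y = 1 := by
  classical
  obtain ⟨t, htK, hcover⟩ := hK.elim_nhds_subcover (fun x => Metric.ball x (r x))
    fun x hx => Metric.ball_mem_nhds x (hr x hx)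
  obtain ⟨f, hf⟩ := SmoothPartitionOfUnity.exists_isSubordinate (modelWithCornersSelf ℝ V)
    hK.isClosed (fun x : t => Metric.ball (x : V) (r x)) (fun _ => Metric.isOpen_ball)
    (by simpa [Set.iUnion_subtype] using hcover)
  refine ⟨t, fun x => if hx : x ∈ t then f ⟨x, hx⟩ else 0, htK, fun x hx => ?_, fun y hy => ?_⟩
  · simp only [hx, dif_pos]
    exact ⟨(f ⟨x, hx⟩).contMDiff.contDiff, f.nonneg _, hf ⟨x, hx⟩⟩
  · rw [← f.sum_eq_one hy, finsum_eq_sum_of_fintype, ← Finset.sum_coe_sort]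
    simp

theorem inner_le_of_mem_closure {V : Type*} [NormedAddCommGroup V] [InnerProductSpace ℝ V]
    {T : Set V} {x₀ x ν : V} {r : ℝ} {ζ : V → ℝ} (hζ : Continuous ζ)
    (hT : ∀ y ∈ Metric.ball x₀ r, y ∈ T ↔ inner ℝ ν y < ζ y) (hx : x ∈ Metric.ball x₀ r)
    (hxT : x ∈ closure T) : inner ℝ ν x ≤ ζ x :=
  closure_minimal (fun y hy => ((hT y hy.1).1 hy.2).le)
    (isClosed_le (f := fun y => inner ℝ ν y) (by fun_prop) hζ)
    (Metric.isOpen_ball.inter_closure ⟨hx, hxT⟩)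

theorem inner_add_sub_smul_lt_of_lipschitz {V : Type*} [NormedAddCommGroup V]
    [InnerProductSpace ℝ V] {ν : V} {K : NNReal} {ζ : V → ℝ} (hν : ‖ν‖ = 1)
    (hζ : LipschitzWith K ζ) (hinv : ∀ y, ∀ t : ℝ, ζ (y + t • ν) = ζ y) {y v : V} {ε : ℝ}
    (hy : inner ℝ ν y ≤ ζ y) (hv : (1 + K) * ‖v‖ < ε) :
    inner ℝ ν (y + (v - ε • ν)) < ζ (y + (v - ε • ν)) := by
  have hshift : ζ (y + (v - ε • ν)) = ζ (y + v) := by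
    rw [← hinv (y + (v - ε • ν)) ε]
    congr 1
    module
  have hlip : ζ y - K * ‖v‖ ≤ ζ (y + v) := by
    have hdist := hζ.dist_le_mul y (y + v)
    rw [dist_self_add_right, Real.dist_eq] at hdist
    linarith [(abs_le.1 hdist).2]
  have hcauchy : inner ℝ ν v ≤ ‖v‖ := by simpa [hν] using real_inner_le_norm ν v
  rw [hshift, inner_add_right, inner_sub_right, inner_smul_right, real_inner_self_eq_norm_sq, hν]
  linarith

theorem HasLipschitzBoundary.exists_forall_le_inner {T : Set (E d)} (hT : HasLipschitzBoundary T)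
    {x₀ : E d} (hx₀ : x₀ ∈ frontier T) :
    ∃ (ν : E d) (r δ : ℝ), 0 < r ∧ 0 < δ ∧ ∀ x ∈ Metric.ball x₀ r, x ∈ frontier T →
      ∀ n, IsOutwardNormalAt T x n → δ ≤ inner ℝ n ν := by
  obtain ⟨ν, hν, r, hr, K, ζ, hζ, hinv, hgraph⟩ := hT x₀ hx₀
  have hδ : 0 < (2 + K : ℝ)⁻¹ := by positivity
  refine ⟨ν, r, (2 + K)⁻¹, hr, hδ, fun x hx hxT n hn => ?_⟩
  have hsmall : (1 + K) * ‖(2 + K : ℝ)⁻¹ • n‖ < 1 := by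
    rw [norm_smul, hn.1, mul_one, Real.norm_of_nonneg hδ.le, ← div_eq_mul_inv,
      div_lt_one (by positivity)]
    linarith
  set v : E d := (2 + K : ℝ)⁻¹ • n with hv
  have hline : Tendsto (fun t : ℝ => x + t • (v - ν)) (𝓝[>] 0) (𝓝 x) :=
    (Continuous.tendsto' (by fun_prop) _ _ (by simp)).mono_left nhdsWithin_le_nhds
  obtain ⟨t, ⟨hball, hiff⟩, ht⟩ := (((hline.eventually (Metric.isOpen_ball.mem_nhds hx)).and
    ((hn.eventually_add_smul_mem_iff _).filter_mono nhdsWithin_le_nhds)).and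
      self_mem_nhdsWithin).exists
  have hmem : x + t • (v - ν) ∈ T := by
    rw [hgraph _ hball, smul_sub]
    refine inner_add_sub_smul_lt_of_lipschitz hν hζ hinv
      (inner_le_of_mem_closure hζ.continuous hgraph hx (frontier_subset_closure hxT)) ?_
    rw [norm_smul, Real.norm_of_nonneg (le_of_lt ht), mul_left_comm]
    exact mul_lt_of_lt_one_right ht hsmall
  have hneg := (pos_iff_neg_of_mul_neg (hiff.1 hmem)).1 ht
  rw [hv, inner_sub_right, inner_smul_right, real_inner_self_eq_norm_sq, hn.1] at hneg
  linarith

theorem HasLipschitzBoundary.exists_transversal_field {T : Set (E d)}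
    (hT : HasLipschitzBoundary T) (hb : Bornology.IsBounded T) :
    ∃ β : Fin d → Fld d, (∀ j, ContDiff ℝ ∞ (β j)) ∧
      ∀ x ∈ frontier T, ∀ n, IsOutwardNormalAt T x n → 1 ≤ ∑ j, β j x * n j := by
  choose! ν r δ hr hδ hν using fun x (hx : x ∈ frontier T) => hT.exists_forall_le_inner hx
  have hK : IsCompact (frontier T) :=
    hb.isCompact_closure.of_isClosed_subset isClosed_frontier frontier_subset_closure
  obtain ⟨t, χ, htK, hχ, hsum⟩ := exists_smooth_partition hK hr
  refine ⟨fun j y => ∑ x ∈ t, χ x y * ((δ x)⁻¹ * ν x j),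
    fun j => ContDiff.sum fun x hx => (hχ x hx).1.mul contDiff_const, fun y hy n hn => ?_⟩
  have hlocal : ∀ x ∈ t, χ x y ≤ χ x y * ((δ x)⁻¹ * inner ℝ n (ν x)) := fun x hx => by
    by_cases hxy : y ∈ tsupport (χ x)
    · refine le_mul_of_one_le_right ((hχ x hx).2.1 y) ?_
      rw [← div_eq_inv_mul, one_le_div (hδ x (htK x hx))]
      exact hν x (htK x hx) y ((hχ x hx).2.2 hxy) hy n hn
    · simp [image_eq_zero_of_notMem_tsupport hxy]
  calc (1 : ℝ) = ∑ x ∈ t, χ x y := (hsum y hy).symm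
    _ ≤ ∑ x ∈ t, χ x y * ((δ x)⁻¹ * inner ℝ n (ν x)) := Finset.sum_le_sum hlocal
    _ = ∑ j, (∑ x ∈ t, χ x y * ((δ x)⁻¹ * ν x j)) * n j := by
        simp only [Finset.sum_mul, PiLp.inner_apply, RCLike.inner_apply, conj_trivial,
          Finset.mul_sum]
        rw [Finset.sum_comm]
        simp only [mul_assoc]

/-- The integrand of the square of the `H¹` norm. -/
def sobolevSq (f : Fld d) (x : E d) : ℝ := f x ^ 2 + ∑ j, pd j f x ^ 2

theorem continuous_sobolevSq {f : Fld d} (hf : ContDiff ℝ 1 f) : Continuous (sobolevSq f) :=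
  (hf.continuous.pow 2).add
    (continuous_finsetSum _ fun j _ => (continuous_pd hf one_ne_zero j).pow 2)

theorem sobolevSq_nonneg (f : Fld d) (x : E d) : 0 ≤ sobolevSq f x :=
  add_nonneg (sq_nonneg _) (Finset.sum_nonneg fun _ _ => sq_nonneg _)

theorem pd_sq_mul_le {f β : Fld d} {x : E d} (hf : DifferentiableAt ℝ f x)
    (hβ : DifferentiableAt ℝ β x) (j : Fin d) :
    pd j (fun y => f y ^ 2 * β y) x ≤ (|β x| + |pd j β x|) * sobolevSq f x := by
  have hpd : pd j (fun y => f y ^ 2 * β y) x = 2 * f x * pd j f x * β x + f x ^ 2 * pd j β x := by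
    simp only [pow_two]
    rw [pd_mul (hf.fun_mul hf) hβ, pd_mul hf hf]
    ring
  have hderiv : pd j f x ^ 2 ≤ ∑ j, pd j f x ^ 2 :=
    Finset.single_le_sum (f := fun j => pd j f x ^ 2) (fun _ _ => sq_nonneg _) (Finset.mem_univ j)
  have hsq : f x ^ 2 ≤ sobolevSq f x := le_add_of_nonneg_right ((sq_nonneg _).trans hderiv)
  have hcross : |2 * f x * pd j f x| ≤ sobolevSq f x := by
    rw [abs_le, sobolevSq]
    constructor <;> nlinarith [sq_nonneg (f x + pd j f x), sq_nonneg (f x - pd j f x)]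
  calc pd j (fun y => f y ^ 2 * β y) x
      ≤ |2 * f x * pd j f x| * |β x| + f x ^ 2 * |pd j β x| := by
        rw [hpd, ← abs_mul]
        gcongr <;> exact le_abs_self _
    _ ≤ sobolevSq f x * |β x| + sobolevSq f x * |pd j β x| := by gcongr
    _ = (|β x| + |pd j β x|) * sobolevSq f x := by ring

namespace FlatBoundary

variable {T : Set (E d)}

theorem exists_integral_sq_mul_outwardNormal_le (B : FlatBoundary T) {β : Fld d}
    (hβ : ContDiff ℝ 1 β) (j : Fin d) :
    ∃ C : ℝ, 0 ≤ C ∧ ∀ f : Fld d, ContDiff ℝ 1 f →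
      ∫ x, f x ^ 2 * β x * outwardNormal T x j ∂(surf (frontier T)) ≤
        C * ∫ x in T, sobolevSq f x := by
  obtain ⟨C, hC⟩ := B.isBounded.isCompact_closure.exists_bound_of_continuousOn
    (f := fun x => |β x| + |pd j β x|)
    (hβ.continuous.abs.add (continuous_pd hβ one_ne_zero j).abs).continuousOn
  refine ⟨max C 0, le_max_right _ _, fun f hf => ?_⟩
  have hprod : ContDiff ℝ 1 fun x => f x ^ 2 * β x := (hf.pow 2).mul hβ
  rw [← B.setIntegral_pd hprod, ← integral_const_mul]
  refine setIntegral_mono_on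
    (integrable_of_continuous_of_isBounded B.isBounded (continuous_pd hprod one_ne_zero j))
    (integrable_of_continuous_of_isBounded B.isBounded ((continuous_sobolevSq hf).const_mul _))
    B.isOpen.measurableSet fun x hx => ?_
  refine (pd_sq_mul_le (hf.differentiable one_ne_zero x) (hβ.differentiable one_ne_zero x) j).trans
    (mul_le_mul_of_nonneg_right ?_ (sobolevSq_nonneg f x))
  exact ((le_abs_self _).trans (hC x (subset_closure hx))).trans (le_max_left _ _)

theorem exists_trace_inequality (B : FlatBoundary T) (hT : HasLipschitzBoundary T) :
    ∃ C : ℝ, 0 ≤ C ∧ ∀ f : Fld d, ContDiff ℝ 1 f →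
      ∫ x, f x ^ 2 ∂(surf (frontier T)) ≤ C * ∫ x in T, sobolevSq f x := by
  obtain ⟨β, hβ, htransversal⟩ := hT.exists_transversal_field B.isBounded
  have hβ1 : ∀ j, ContDiff ℝ 1 (β j) := fun j => (hβ j).of_le (by norm_cast)
  choose C hC0 hC using fun j => B.exists_integral_sq_mul_outwardNormal_le (hβ1 j) j
  refine ⟨∑ j, C j, Finset.sum_nonneg fun j _ => hC0 j, fun f hf => ?_⟩
  have hint : ∀ j, Integrable (fun x => f x ^ 2 * β j x * outwardNormal T x j)
      (surf (frontier T)) := fun j =>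
    memLp_one_iff_integrable.1 (B.memLp_mul_outwardNormal (B.memLp_surf_frontier_of_continuous
      ((hf.continuous.pow 2).mul (hβ j).continuous) 1) j)
  calc ∫ x, f x ^ 2 ∂(surf (frontier T))
      ≤ ∫ x, ∑ j, f x ^ 2 * β j x * outwardNormal T x j ∂(surf (frontier T)) := by
        refine integral_mono_ae
          (memLp_one_iff_integrable.1 (B.memLp_surf_frontier_of_continuous (hf.continuous.pow 2) 1))
          (integrable_finsetSum _ fun j _ => hint j) ?_
        filter_upwards [B.ae_isOutwardNormalAt, ae_restrict_mem isClosed_frontier.measurableSet]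
          with x hx hxT
        simp only [mul_assoc, ← Finset.mul_sum]
        exact le_mul_of_one_le_right (sq_nonneg _) (htransversal x hxT _ hx)
    _ = ∑ j, ∫ x, f x ^ 2 * β j x * outwardNormal T x j ∂(surf (frontier T)) :=
        integral_finsetSum _ fun j _ => hint j
    _ ≤ ∑ j, C j * ∫ x in T, sobolevSq f x := Finset.sum_le_sum fun j _ => hC j f hf
    _ = (∑ j, C j) * ∫ x in T, sobolevSq f x := by rw [Finset.sum_mul]

end FlatBoundary

/-! ### Mollification in `Lᵖ` -/

section Mollification

open ContinuousLinearMap (lsmul)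
open scoped Convolution ENNReal Pointwise

theorem rpow_lintegral_enorm_le {α F : Type*} [MeasurableSpace α] [NormedAddCommGroup F]
    {μ : Measure α} [IsProbabilityMeasure μ] {f : α → F} (hf : AEStronglyMeasurable f μ)
    {q : ℝ} (hq : 1 ≤ q) : (∫⁻ x, ‖f x‖ₑ ∂μ) ^ q ≤ ∫⁻ x, ‖f x‖ₑ ^ q ∂μ := by
  have h := eLpNorm'_le_eLpNorm'_of_exponent_le zero_lt_one hq μ hf
  simp only [eLpNorm', ENNReal.rpow_one, one_div, inv_one] at h
  exact (ENNReal.le_rpow_inv_iff (zero_lt_one.trans_le hq)).1 h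

variable {V F : Type*} [NormedAddCommGroup V] [NormedSpace ℝ V] [MeasurableSpace V]
  [NormedAddCommGroup F] [NormedSpace ℝ F] {μ : Measure V} {p : ℝ≥0∞}

/-- A smooth compactly supported probability density. It need not be centred at the origin, so that
convolution with it can shift a function into the interior of its domain. -/
structure IsMollifier (μ : Measure V) (ρ : V → ℝ) : Prop where
  contDiff : ContDiff ℝ ∞ ρ
  hasCompactSupport : HasCompactSupport ρ
  nonneg : ∀ x, 0 ≤ ρ x
  integral_eq_one : ∫ x, ρ x ∂μ = 1

namespace IsMollifier

variable {ρ : V → ℝ} {u : V → F}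

theorem isProbabilityMeasure_withDensity (hρ : IsMollifier μ ρ) :
    IsProbabilityMeasure (μ.withDensity fun x => ENNReal.ofReal (ρ x)) := by
  refine ⟨?_⟩
  rw [withDensity_apply _ MeasurableSet.univ, setLIntegral_univ,
    ← ofReal_integral_eq_lintegral_ofReal (integrable_of_integral_eq_one hρ.integral_eq_one)
    (Eventually.of_forall hρ.nonneg), hρ.integral_eq_one, ENNReal.ofReal_one]

theorem enorm_convolution_le [BorelSpace V] (hρ : IsMollifier μ ρ) (u : V → F) (x : V) :
    ‖(ρ ⋆[lsmul ℝ ℝ, μ] u) x‖ₑ ≤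
      ∫⁻ t, ‖u (x - t)‖ₑ ∂(μ.withDensity fun t => ENNReal.ofReal (ρ t)) := by
  rw [lintegral_withDensity_eq_lintegral_mul_non_measurable _
    hρ.contDiff.continuous.measurable.ennreal_ofReal
    (Eventually.of_forall fun _ => ENNReal.ofReal_lt_top)]
  refine (enorm_integral_le_lintegral_enorm _).trans_eq (lintegral_congr fun t => ?_)
  rw [ContinuousLinearMap.lsmul_apply, enorm_smul, Real.enorm_of_nonneg (hρ.nonneg t)]
  rfl

variable [FiniteDimensional ℝ V] [BorelSpace V] [μ.IsAddHaarMeasure]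

theorem eLpNorm_convolution_le (hρ : IsMollifier μ ρ) (hp : 1 ≤ p) (hp' : p ≠ ⊤)
    (hu : AEStronglyMeasurable u μ) :
    eLpNorm (ρ ⋆[lsmul ℝ ℝ, μ] u) p μ ≤ eLpNorm u p μ := by
  have hq : 1 ≤ p.toReal := by simpa using ENNReal.toReal_mono hp' hp
  have hp0 : p ≠ 0 := (zero_lt_one.trans_le hp).ne'
  rw [eLpNorm_eq_lintegral_rpow_enorm_toReal hp0 hp',
    eLpNorm_eq_lintegral_rpow_enorm_toReal hp0 hp']
  refine ENNReal.rpow_le_rpow ?_ (by positivity)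
  set ν : Measure V := μ.withDensity fun t => ENNReal.ofReal (ρ t)
  have : IsProbabilityMeasure ν := hρ.isProbabilityMeasure_withDensity
  have hshift : ∀ x, AEStronglyMeasurable (fun t => u (x - t)) ν := fun x =>
    (hu.comp_quasiMeasurePreserving (quasiMeasurePreserving_sub_left μ x)).mono_ac
      (withDensity_absolutelyContinuous _ _)
  have hsub : AEMeasurable (fun z : V × V => ‖u (z.1 - z.2)‖ₑ ^ p.toReal) (μ.prod ν) :=
    (hu.comp_quasiMeasurePreserving
      (quasiMeasurePreserving_sub_of_right_invariant μ ν)).enorm.pow_const _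
  calc ∫⁻ x, ‖(ρ ⋆[lsmul ℝ ℝ, μ] u) x‖ₑ ^ p.toReal ∂μ
      ≤ ∫⁻ x, (∫⁻ t, ‖u (x - t)‖ₑ ∂ν) ^ p.toReal ∂μ := by
        gcongr with x
        exact hρ.enorm_convolution_le u x
    _ ≤ ∫⁻ x, ∫⁻ t, ‖u (x - t)‖ₑ ^ p.toReal ∂ν ∂μ := by
        gcongr with x
        exact rpow_lintegral_enorm_le (hshift x) hq
    _ = ∫⁻ t, ∫⁻ x, ‖u (x - t)‖ₑ ^ p.toReal ∂μ ∂ν := lintegral_lintegral_swap hsub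
    _ = ∫⁻ x, ‖u x‖ₑ ^ p.toReal ∂μ := by
        simp only [lintegral_sub_right_eq_self fun x => ‖u x‖ₑ ^ p.toReal, lintegral_const,
          measure_univ, mul_one]

theorem convolutionExistsAt (hρ : IsMollifier μ ρ) (hu : LocallyIntegrable u μ) (x : V) :
    ConvolutionExistsAt ρ u x (lsmul ℝ ℝ) μ :=
  hρ.hasCompactSupport.convolutionExists_left _ hρ.contDiff.continuous hu x

theorem contDiff_convolution (hρ : IsMollifier μ ρ) (hu : LocallyIntegrable u μ) :
    ContDiff ℝ ∞ (ρ ⋆[lsmul ℝ ℝ, μ] u) :=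
  hρ.hasCompactSupport.contDiff_convolution_left (n := ⊤) _ hρ.contDiff hu

theorem aestronglyMeasurable_convolution (hρ : IsMollifier μ ρ) (hu : LocallyIntegrable u μ) :
    AEStronglyMeasurable (ρ ⋆[lsmul ℝ ℝ, μ] u) μ :=
  (hρ.contDiff_convolution hu).continuous.aestronglyMeasurable

theorem convolution_sub (hρ : IsMollifier μ ρ) {w : V → F} (hu : LocallyIntegrable u μ)
    (hw : LocallyIntegrable w μ) :
    ρ ⋆[lsmul ℝ ℝ, μ] (u - w) = ρ ⋆[lsmul ℝ ℝ, μ] u - ρ ⋆[lsmul ℝ ℝ, μ] w := by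
  ext x
  simp only [convolution_def, Pi.sub_apply, map_sub]
  exact integral_sub (hρ.convolutionExistsAt hu x) (hρ.convolutionExistsAt hw x)

theorem eLpNorm_convolution_sub_self_le [CompleteSpace F] (hρ : IsMollifier μ ρ) (hp : p ≠ ⊤)
    {r κ : ℝ} (hκ : 0 ≤ κ) (hr : Function.support ρ ⊆ Metric.ball 0 r) {g : V → F}
    (hgc : HasCompactSupport g) (hg : Continuous g)
    (hosc : ∀ x, ∀ y ∈ Metric.ball x r, dist (g y) (g x) ≤ κ) :
    eLpNorm (ρ ⋆[lsmul ℝ ℝ, μ] g - g) p μ ≤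
      ENNReal.ofReal κ * μ (Metric.cthickening r (tsupport g)) ^ (1 / p.toReal) := by
  have hself : tsupport g ⊆ Metric.cthickening r (tsupport g) :=
    Metric.self_subset_cthickening _
  refine eLpNorm_sub_le_of_dist_bdd μ hp hgc.isCompact.cthickening.measurableSet hκ
    (fun x => dist_convolution_le hκ hr hρ.nonneg hρ.integral_eq_one hg.aestronglyMeasurable
      (hosc x)) ?_ ((subset_tsupport g).trans hself)
  calc Function.support (ρ ⋆[lsmul ℝ ℝ, μ] g)
      ⊆ Function.support ρ + Function.support g := support_convolution_subset _
    _ ⊆ Metric.ball 0 r + tsupport g := Set.add_subset_add hr (subset_tsupport g)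
    _ = Metric.thickening r (tsupport g) := by rw [add_comm, add_ball_zero]
    _ ⊆ Metric.cthickening r (tsupport g) := Metric.thickening_subset_cthickening _ _

end IsMollifier

variable [FiniteDimensional ℝ V] [BorelSpace V] [μ.IsAddHaarMeasure] [CompleteSpace F]
  {ρ : ℕ → V → ℝ} {r : ℕ → ℝ}

theorem tendsto_eLpNorm_convolution_sub_self_of_continuous (hp : p ≠ ⊤)
    (hρ : ∀ m, IsMollifier μ (ρ m))
    (hρr : ∀ m, Function.support (ρ m) ⊆ Metric.ball 0 (r m)) (hr : Tendsto r atTop (𝓝 0))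
    {g : V → F} (hgc : HasCompactSupport g) (hg : Continuous g) :
    Tendsto (fun m => eLpNorm (ρ m ⋆[lsmul ℝ ℝ, μ] g - g) p μ) atTop (𝓝 0) := by
  rw [ENNReal.tendsto_nhds_zero]
  intro ε hε
  set C : ℝ≥0∞ := μ (Metric.cthickening 1 (tsupport g)) ^ (1 / p.toReal)
  have hC : C ≠ ⊤ :=
    ENNReal.rpow_ne_top_of_nonneg (by positivity) hgc.isCompact.cthickening.measure_lt_top.ne
  obtain ⟨κ, hκ, hκε⟩ := ENNReal.exists_nnreal_pos_mul_lt hC hε.ne'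
  obtain ⟨δ, hδ, hosc⟩ :=
    Metric.uniformContinuous_iff.1 (hgc.uniformContinuous_of_continuous hg) κ hκ
  filter_upwards [hr.eventually (gt_mem_nhds hδ), hr.eventually (gt_mem_nhds one_pos)]
    with m hmδ hm1
  calc eLpNorm (ρ m ⋆[lsmul ℝ ℝ, μ] g - g) p μ
      ≤ ENNReal.ofReal κ * μ (Metric.cthickening (r m) (tsupport g)) ^ (1 / p.toReal) :=
        (hρ m).eLpNorm_convolution_sub_self_le hp κ.2 (hρr m) hgc hg fun x y hy =>
          (hosc ((Metric.mem_ball.1 hy).trans hmδ)).le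
    _ ≤ κ * C := by
        rw [ENNReal.ofReal_coe_nnreal]
        gcongr
        exact ENNReal.rpow_le_rpow (measure_mono (Metric.cthickening_mono hm1.le _))
          (by positivity)
    _ ≤ ε := hκε.le

theorem tendsto_eLpNorm_convolution_sub_self (hp : 1 ≤ p) (hp' : p ≠ ⊤)
    (hρ : ∀ m, IsMollifier μ (ρ m))
    (hρr : ∀ m, Function.support (ρ m) ⊆ Metric.ball 0 (r m)) (hr : Tendsto r atTop (𝓝 0))
    {u : V → F} (hu : MemLp u p μ) :
    Tendsto (fun m => eLpNorm (ρ m ⋆[lsmul ℝ ℝ, μ] u - u) p μ) atTop (𝓝 0) := by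
  rw [ENNReal.tendsto_nhds_zero]
  intro ε hε
  have hthree : (3 : ℝ≥0∞) ≠ ⊤ := ENNReal.ofNat_ne_top
  obtain ⟨g, hgc, hug, hg, hgL⟩ :=
    hu.exists_hasCompactSupport_eLpNorm_sub_le hp' (ENNReal.div_pos hε.ne' hthree).ne'
  filter_upwards [ENNReal.tendsto_nhds_zero.1
    (tendsto_eLpNorm_convolution_sub_self_of_continuous hp' hρ hρr hr hgc hg) (ε / 3)
    (ENNReal.div_pos hε.ne' hthree)] with m hm
  have huloc := hu.locallyIntegrable hp
  have hgloc := hgL.locallyIntegrable hp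
  have hsplit : ρ m ⋆[lsmul ℝ ℝ, μ] u - u =
      ρ m ⋆[lsmul ℝ ℝ, μ] (u - g) + (ρ m ⋆[lsmul ℝ ℝ, μ] g - g) + (g - u) := by
    rw [(hρ m).convolution_sub huloc hgloc]
    abel
  have hmeas := (hρ m).aestronglyMeasurable_convolution (huloc.sub hgloc)
  have hmeas' := ((hρ m).aestronglyMeasurable_convolution hgloc).sub hgL.1
  calc eLpNorm (ρ m ⋆[lsmul ℝ ℝ, μ] u - u) p μ
      ≤ eLpNorm (ρ m ⋆[lsmul ℝ ℝ, μ] (u - g)) p μ + eLpNorm (ρ m ⋆[lsmul ℝ ℝ, μ] g - g) p μ +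
          eLpNorm (g - u) p μ := by
        rw [hsplit]
        refine (eLpNorm_add_le (hmeas.add hmeas') (hgL.1.sub hu.1) hp).trans ?_
        gcongr
        exact eLpNorm_add_le hmeas hmeas' hp
    _ ≤ ε / 3 + ε / 3 + ε / 3 := by
        rw [eLpNorm_sub_comm g u]
        gcongr
        exact ((hρ m).eLpNorm_convolution_le hp hp' (hu.1.sub hgL.1)).trans hug
    _ = ε := ENNReal.add_thirds ε

end Mollification

/-! ### Density of smooth functions in `H¹` -/

section Density

open ContinuousLinearMap (lsmul)
open scoped Convolution

theorem TendstoL2.mono_measure {μ ν : Measure (E d)} (hμν : ν ≤ μ) {f : ℕ → Fld d} {g : Fld d}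
    (h : TendstoL2 μ f g) : TendstoL2 ν f g :=
  tendsto_of_tendsto_of_tendsto_of_le_of_le tendsto_const_nhds h (fun _ => zero_le)
    fun _ => eLpNorm_mono_measure _ hμν

theorem TendstoL2.congr {μ : Measure (E d)} {f f' : ℕ → Fld d} {g g' : Fld d}
    (h : TendstoL2 μ f g) (hf : ∀ m, f m =ᵐ[μ] f' m) (hg : g =ᵐ[μ] g') : TendstoL2 μ f' g' :=
  Tendsto.congr (fun m => eLpNorm_congr_ae ((hf m).sub hg)) h

theorem TendstoL2.finsetSum {ι : Type*} {s : Finset ι} {μ : Measure (E d)} {f : ι → ℕ → Fld d}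
    {g : ι → Fld d} (hf : ∀ i ∈ s, ∀ m, AEStronglyMeasurable (f i m) μ)
    (hg : ∀ i ∈ s, AEStronglyMeasurable (g i) μ) (h : ∀ i ∈ s, TendstoL2 μ (f i) (g i)) :
    TendstoL2 μ (fun m => ∑ i ∈ s, f i m) (∑ i ∈ s, g i) := by
  have hlim : Tendsto (fun m => ∑ i ∈ s, eLpNorm (fun x => f i m x - g i x) 2 μ) atTop (𝓝 0) := by
    simpa only [Finset.sum_const_zero] using tendsto_finsetSum s h
  refine tendsto_of_tendsto_of_tendsto_of_le_of_le tendsto_const_nhds hlim (fun _ => zero_le)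
    fun m => ?_
  change eLpNorm (∑ i ∈ s, f i m - ∑ i ∈ s, g i) 2 μ ≤ _
  rw [← Finset.sum_sub_distrib]
  exact eLpNorm_sum_le (fun i hi => (hf i hi m).sub (hg i hi)) one_le_two

/-- `g` is the gradient of `v` on `Ω` in the weak sense, i.e. in the sense of distributions. -/
def IsWeakGradient (Ω : Set (E d)) (v : Fld d) (g : Fin d → Fld d) : Prop :=
  ∀ j, ∀ φ : Fld d, IsTest Ω φ → ∫ x in Ω, v x * pd j φ x = - ∫ x in Ω, g j x * φ x

/-- `g` is the gradient of `v` on `Ω` in the strong sense: `v` and `g` are the limits in `L²(Ω)` of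
functions that are smooth up to the boundary and of their gradients. -/
def IsStrongGradient (Ω : Set (E d)) (v : Fld d) (g : Fin d → Fld d) : Prop :=
  ∃ φ : ℕ → Fld d, (∀ m, ContDiff ℝ ∞ (φ m)) ∧ TendstoL2 (vol Ω) φ v ∧
    ∀ j, TendstoL2 (vol Ω) (fun m => pd j (φ m)) (g j)

theorem pd_sum {ι : Type*} {s : Finset ι} {f : ι → Fld d} {x : E d}
    (hf : ∀ i ∈ s, DifferentiableAt ℝ (f i) x) (j : Fin d) :
    pd j (∑ i ∈ s, f i) x = ∑ i ∈ s, pd j (f i) x := by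
  simp only [pd, fderiv_sum hf, sum_apply]

theorem IsStrongGradient.finsetSum {ι : Type*} {s : Finset ι} {Ω : Set (E d)} {v : ι → Fld d}
    {g : ι → Fin d → Fld d} (hv : ∀ i ∈ s, AEStronglyMeasurable (v i) (vol Ω))
    (hg : ∀ i ∈ s, ∀ j, AEStronglyMeasurable (g i j) (vol Ω))
    (h : ∀ i ∈ s, IsStrongGradient Ω (v i) (g i)) :
    IsStrongGradient Ω (∑ i ∈ s, v i) fun j => ∑ i ∈ s, g i j := by
  choose! φ hφ hφv hφg using h
  refine ⟨fun m => ∑ i ∈ s, φ i m, fun m => ?_, ?_, fun j => ?_⟩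
  · simpa [Finset.sum_fn] using ContDiff.sum fun i hi => hφ i hi m
  · exact .finsetSum (fun i hi m => (hφ i hi m).continuous.aestronglyMeasurable) hv hφv
  · refine (TendstoL2.finsetSum (fun i hi m => ?_) (fun i hi => hg i hi j)
      fun i hi => hφg i hi j).congr (fun m => .of_eq ?_) EventuallyEq.rfl
    · exact (continuous_pd (hφ i hi m) (by simp) j).aestronglyMeasurable
    · ext x
      rw [pd_sum (fun i hi => (hφ i hi m).differentiable (by simp) x), Finset.sum_apply]

theorem IsStrongGradient.congr {Ω : Set (E d)} {v v' : Fld d} {g g' : Fin d → Fld d}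
    (h : IsStrongGradient Ω v g) (hv : v =ᵐ[vol Ω] v') (hg : ∀ j, g j =ᵐ[vol Ω] g' j) :
    IsStrongGradient Ω v' g' := by
  obtain ⟨φ, hφ, hφv, hφg⟩ := h
  exact ⟨φ, hφ, hφv.congr (fun _ => EventuallyEq.rfl) hv,
    fun j => (hφg j).congr (fun _ => EventuallyEq.rfl) (hg j)⟩

theorem hasCompactSupport_pd {f : Fld d} (hf : HasCompactSupport f) (j : Fin d) :
    HasCompactSupport (pd j f) :=
  (hf.fderiv ℝ).comp_left (g := fun L : E d →L[ℝ] ℝ => L (EuclideanSpace.single j 1)) (by simp)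

theorem pd_convolution {ρ u : Fld d} (hρ : ContDiff ℝ 1 ρ) (hρc : HasCompactSupport ρ)
    (hu : LocallyIntegrable u) (j : Fin d) :
    pd j (ρ ⋆[lsmul ℝ ℝ] u) = pd j ρ ⋆[lsmul ℝ ℝ] u := by
  ext x
  have hex : ConvolutionExistsAt (fderiv ℝ ρ) u x ((lsmul ℝ ℝ).precompL (E d)) volume :=
    (hρc.fderiv ℝ).convolutionExists_left _ (hρ.continuous_fderiv one_ne_zero) hu x
  rw [pd, (hρc.hasFDerivAt_convolution_left _ hρ hu x).fderiv, convolution_def,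
    ContinuousLinearMap.integral_apply hex]
  rfl

theorem convolution_indicator {Ω : Set (E d)} (hΩ : MeasurableSet Ω) (ρ b : Fld d) (x : E d) :
    (ρ ⋆[lsmul ℝ ℝ] Ω.indicator b) x = ∫ z in Ω, ρ (x - z) * b z := by
  rw [convolution_lsmul_swap, ← integral_indicator hΩ]
  simp only [smul_eq_mul, Set.indicator_mul_right]

theorem pd_comp_const_sub {ρ : Fld d} {x z : E d} (hρ : DifferentiableAt ℝ ρ (x - z))
    (j : Fin d) : pd j (fun z => ρ (x - z)) z = - pd j ρ (x - z) := by
  have h : fderiv ℝ (fun z => ρ (x - z)) z = _ :=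
    (hρ.hasFDerivAt.comp z ((hasFDerivAt_id z).const_sub x)).fderiv
  simp [pd, h]

theorem isTest_mul_comp_const_sub {Ω : Set (E d)} {χ ρ : Fld d} (hχ : ContDiff ℝ ∞ χ)
    (hχc : HasCompactSupport χ) (hρ : ContDiff ℝ ∞ ρ) {x : E d}
    (hx : ∀ z ∈ tsupport χ, x - z ∈ tsupport ρ → z ∈ Ω) :
    IsTest Ω (fun z => χ z * ρ (x - z)) := by
  refine ⟨hχ.mul (hρ.comp (contDiff_const.sub contDiff_id)), hχc.mul_right, fun z hz => ?_⟩
  have hclosed : IsClosed {z | x - z ∈ tsupport ρ} :=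
    (isClosed_tsupport ρ).preimage (continuous_const.sub continuous_id)
  refine hx z (closure_mono (Function.support_mul_subset_left _ _) hz)
    (closure_minimal (fun y hy => ?_) hclosed hz)
  exact subset_tsupport ρ (right_ne_zero_of_mul hy)

theorem memLp_mul_of_hasCompactSupport {μ : Measure (E d)} {v χ : Fld d} (hv : MemLp v 2 μ)
    (hχ : Continuous χ) (hχc : HasCompactSupport χ) : MemLp (fun z => χ z * v z) 2 μ :=
  hv.mul (hχ.memLp_top_of_hasCompactSupport hχc μ)

theorem locallyIntegrable_indicator {Ω : Set (E d)} (hΩ : MeasurableSet Ω) {u : Fld d}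
    (hu : MemLp u 2 (vol Ω)) : LocallyIntegrable (Ω.indicator u) :=
  ((memLp_indicator_iff_restrict hΩ).2 hu).locallyIntegrable one_le_two

theorem IsWeakGradient.pd_convolution_indicator {Ω : Set (E d)} (hΩ : MeasurableSet Ω)
    {v χ ρ : Fld d} {g : Fin d → Fld d} (hweak : IsWeakGradient Ω v g) (hv : MemLp v 2 (vol Ω))
    (hg : ∀ j, MemLp (g j) 2 (vol Ω)) (hχ : ContDiff ℝ ∞ χ) (hχc : HasCompactSupport χ)
    (hρ : IsMollifier volume ρ) {x : E d} (hx : ∀ z ∈ tsupport χ, x - z ∈ tsupport ρ → z ∈ Ω)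
    (j : Fin d) :
    pd j (ρ ⋆[lsmul ℝ ℝ] Ω.indicator fun z => χ z * v z) x =
      (ρ ⋆[lsmul ℝ ℝ] Ω.indicator fun z => χ z * g j z + pd j χ z * v z) x := by
  have htest := isTest_mul_comp_const_sub hχ hχc hρ.contDiff hx
  have hpdχ : Continuous (pd j χ) := continuous_pd hχ (by simp) j
  have hρx : Continuous fun z => ρ (x - z) := hρ.contDiff.continuous.comp (by fun_prop)
  have hintegrable : ∀ {w a : Fld d}, MemLp w 2 (vol Ω) → Continuous a → HasCompactSupport a →
      Integrable (fun z => w z * a z) (vol Ω) := fun hw ha hac =>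
    hw.integrable_mul (ha.memLp_of_hasCompactSupport (p := 2) hac)
  have hpd_mul : ∀ z, pd j (fun z => χ z * ρ (x - z)) z =
      pd j χ z * ρ (x - z) - χ z * pd j ρ (x - z) := fun z => by
    have hdiff := hρ.contDiff.differentiable (by simp) (x - z)
    rw [pd_mul (g := fun z => ρ (x - z)) (hχ.differentiable (by simp) z)
      (hdiff.comp z (by fun_prop)), pd_comp_const_sub hdiff]
    ring
  have hvχ : Integrable (fun z => v z * (pd j χ z * ρ (x - z))) (vol Ω) :=
    hintegrable hv (hpdχ.mul hρx) (hasCompactSupport_pd hχc j).mul_right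
  calc pd j (ρ ⋆[lsmul ℝ ℝ] Ω.indicator fun z => χ z * v z) x
      = ∫ z in Ω, (v z * (pd j χ z * ρ (x - z)) - v z * pd j (fun z => χ z * ρ (x - z)) z) := by
        rw [pd_convolution (hρ.contDiff.of_le (by norm_cast)) hρ.hasCompactSupport
          (locallyIntegrable_indicator hΩ (memLp_mul_of_hasCompactSupport hv hχ.continuous hχc)),
          convolution_indicator hΩ]
        simp only [hpd_mul]
        congr 1 with z
        ring
    _ = (∫ z in Ω, v z * (pd j χ z * ρ (x - z))) + ∫ z in Ω, g j z * (χ z * ρ (x - z)) := by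
        rw [integral_sub hvχ (hintegrable hv (continuous_pd htest.1 (by simp) j)
          (hasCompactSupport_pd htest.2.1 j)), hweak j _ htest, sub_neg_eq_add]
    _ = ∫ z in Ω, ρ (x - z) * (χ z * g j z + pd j χ z * v z) := by
        rw [← integral_add hvχ (hintegrable (hg j) htest.1.continuous htest.2.1)]
        congr 1 with z
        ring
    _ = _ := (convolution_indicator hΩ _ _ x).symm

theorem HasLipschitzBoundary.exists_shift {Ω : Set (E d)} (hL : HasLipschitzBoundary Ω)
    (hΩ : IsOpen Ω) {x₀ : E d} (hx₀ : x₀ ∈ closure Ω) :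
    ∃ (ν : E d) (r κ : ℝ), ‖ν‖ ≤ 1 ∧ 0 < r ∧ 0 < κ ∧ κ ≤ 1 ∧
      ∀ y ∈ Ω, y ∈ Metric.ball x₀ r → ∀ ε > 0, ∀ w ∈ Metric.closedBall (ε • ν) (κ * ε),
        y - w ∈ Metric.ball x₀ r → y - w ∈ Ω := by
  by_cases hmem : x₀ ∈ Ω
  · obtain ⟨r, hr, hball⟩ := Metric.isOpen_iff.1 hΩ x₀ hmem
    exact ⟨0, r, 1, by simp, hr, one_pos, le_rfl, fun y _ _ ε _ w _ hw => hball hw⟩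
  obtain ⟨ν, hν, r, hr, K, ζ, hζ, hinv, hgraph⟩ := hL x₀ ⟨hx₀, fun h => hmem (interior_subset h)⟩
  have hκ1 : (2 + K : ℝ)⁻¹ ≤ 1 := inv_le_one_of_one_le₀ (by linarith [K.coe_nonneg])
  refine ⟨ν, r, (2 + K)⁻¹, hν.le, hr, by positivity, hκ1, fun y hy hyr ε hε w hw hwr => ?_⟩
  rw [mem_closedBall_iff_norm'] at hw
  have hsmall : (1 + K) * ‖ε • ν - w‖ < ε := by
    calc (1 + K) * ‖ε • ν - w‖ ≤ (1 + K) * ((2 + K : ℝ)⁻¹ * ε) := by gcongr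
      _ = ((1 + K) / (2 + K)) * ε := by ring
      _ < ε := mul_lt_of_lt_one_left hε ((div_lt_one (by positivity)).2 (by linarith))
  have hshift := inner_add_sub_smul_lt_of_lipschitz hν hζ hinv ((hgraph y hyr).1 hy).le hsmall
  rwa [show y + (ε • ν - w - ε • ν) = y - w by abel, ← hgraph _ hwr] at hshift

theorem exists_isMollifier_tsupport_subset {V : Type*} [NormedAddCommGroup V] [NormedSpace ℝ V]
    [FiniteDimensional ℝ V] [MeasurableSpace V] [BorelSpace V] (μ : Measure V)
    [μ.IsAddHaarMeasure] [HasContDiffBump V] (a : V) {ε : ℝ} (hε : 0 < ε) :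
    ∃ ρ : V → ℝ, IsMollifier μ ρ ∧ tsupport ρ ⊆ Metric.closedBall a ε := by
  let b : ContDiffBump a := ⟨ε / 2, ε, half_pos hε, half_lt_self hε⟩
  exact ⟨b.normed μ, ⟨b.contDiff_normed, b.hasCompactSupport_normed, b.nonneg_normed,
    b.integral_normed⟩, b.tsupport_normed_eq.subset⟩

theorem HasLipschitzBoundary.exists_isMollifier {Ω : Set (E d)} (hL : HasLipschitzBoundary Ω)
    (hΩ : IsOpen Ω) {x₀ : E d} (hx₀ : x₀ ∈ closure Ω) :
    ∃ r > 0, ∀ δ > 0, ∃ ρ : Fld d, IsMollifier volume ρ ∧ tsupport ρ ⊆ Metric.ball 0 δ ∧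
      ∀ y ∈ Ω, y ∈ Metric.ball x₀ r → ∀ w ∈ tsupport ρ, y - w ∈ Metric.ball x₀ r → y - w ∈ Ω := by
  obtain ⟨ν, r, κ, hν, hr, hκ, hκ1, hshift⟩ := hL.exists_shift hΩ hx₀
  refine ⟨r, hr, fun δ hδ => ?_⟩
  have hε : 0 < δ / 3 := by positivity
  obtain ⟨ρ, hρ, hsupp⟩ :=
    exists_isMollifier_tsupport_subset volume ((δ / 3) • ν) (mul_pos hκ hε)
  refine ⟨ρ, hρ, hsupp.trans (Metric.closedBall_subset_ball' ?_),
    fun y hy hyr w hw hwr => hshift y hy hyr _ hε w (hsupp hw) hwr⟩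
  rw [dist_zero_right, norm_smul, Real.norm_of_nonneg hε.le]
  nlinarith

theorem IsWeakGradient.exists_isStrongGradient_mul {Ω : Set (E d)} {v : Fld d}
    {g : Fin d → Fld d} (hweak : IsWeakGradient Ω v g) (hΩ : IsOpen Ω)
    (hL : HasLipschitzBoundary Ω) (hv : MemLp v 2 (vol Ω)) (hg : ∀ j, MemLp (g j) 2 (vol Ω))
    {x₀ : E d} (hx₀ : x₀ ∈ closure Ω) :
    ∃ r > 0, ∀ χ : Fld d, ContDiff ℝ ∞ χ → tsupport χ ⊆ Metric.ball x₀ r →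
      IsStrongGradient Ω (fun z => χ z * v z) fun j z => χ z * g j z + pd j χ z * v z := by
  obtain ⟨r, hr, hmoll⟩ := hL.exists_isMollifier hΩ hx₀
  refine ⟨r / 2, half_pos hr, fun χ hχ hχs => ?_⟩
  obtain ⟨δ, -, hδ, hδ0⟩ := exists_seq_strictAnti_tendsto' (half_pos hr)
  choose ρ hρ hρδ hshift using fun m => hmoll (δ m) (hδ m).1
  have hχc : HasCompactSupport χ := (isCompact_closedBall x₀ (r / 2)).of_isClosed_subset
    (isClosed_tsupport _) (hχs.trans Metric.ball_subset_closedBall)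
  have hΩm := hΩ.measurableSet
  have hχv := memLp_mul_of_hasCompactSupport hv hχ.continuous hχc
  have hχg : ∀ j, MemLp (fun z => χ z * g j z + pd j χ z * v z) 2 (vol Ω) := fun j =>
    (memLp_mul_of_hasCompactSupport (hg j) hχ.continuous hχc).add
      (memLp_mul_of_hasCompactSupport hv (continuous_pd hχ (by simp) j)
        (hasCompactSupport_pd hχc j))
  have hlim : ∀ {u : Fld d}, MemLp u 2 (vol Ω) →
      TendstoL2 (vol Ω) (fun m => ρ m ⋆[lsmul ℝ ℝ] Ω.indicator u) u := fun {u} hu =>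
    (TendstoL2.mono_measure Measure.restrict_le_self (tendsto_eLpNorm_convolution_sub_self
      one_le_two ENNReal.ofNat_ne_top hρ (fun m => (subset_tsupport _).trans (hρδ m)) hδ0
      ((memLp_indicator_iff_restrict hΩm).2 hu))).congr (fun _ => EventuallyEq.rfl)
      (indicator_ae_eq_restrict hΩm)
  refine ⟨fun m => ρ m ⋆[lsmul ℝ ℝ] Ω.indicator fun z => χ z * v z,
    fun m => (hρ m).contDiff_convolution (locallyIntegrable_indicator hΩm hχv), hlim hχv,
    fun j => (hlim (hχg j)).congr (fun m => ?_) EventuallyEq.rfl⟩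
  filter_upwards [ae_restrict_mem hΩm] with y hy
  refine (hweak.pd_convolution_indicator hΩm hv hg hχ hχc (hρ m) (fun z hz hyz => ?_) j).symm
  have hzr : dist z x₀ < r / 2 := hχs hz
  have hyz_lt : dist y z < δ m := by simpa [dist_eq_norm] using hρδ m hyz
  have hδr := (hδ m).2
  have hyr : y ∈ Metric.ball x₀ r := by
    rw [Metric.mem_ball]
    linarith [dist_triangle y z x₀]
  have hzΩ := hshift m y hy hyr (y - z) hyz
  rw [sub_sub_cancel] at hzΩ
  exact hzΩ (Metric.ball_subset_ball (half_le_self hr.le) hzr)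

theorem IsWeakGradient.isStrongGradient {Ω : Set (E d)} {v : Fld d} {g : Fin d → Fld d}
    (hweak : IsWeakGradient Ω v g) (hΩ : IsOpen Ω) (hb : Bornology.IsBounded Ω)
    (hL : HasLipschitzBoundary Ω) (hv : MemLp v 2 (vol Ω)) (hg : ∀ j, MemLp (g j) 2 (vol Ω)) :
    IsStrongGradient Ω v g := by
  choose! r hr hlocal using fun x (hx : x ∈ closure Ω) =>
    hweak.exists_isStrongGradient_mul hΩ hL hv hg hx
  obtain ⟨t, χ, htK, hχ, hsum⟩ := exists_smooth_partition hb.isCompact_closure hr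
  have hsum_pd : ∀ y ∈ Ω, ∀ j, ∑ x ∈ t, pd j (χ x) y = 0 := fun y hy j => by
    have hone : ∑ x ∈ t, χ x =ᶠ[𝓝 y] fun _ => 1 := by
      filter_upwards [hΩ.mem_nhds hy] with z hz
      rw [Finset.sum_apply, hsum z (subset_closure hz)]
    rw [← pd_sum fun x hx => (hχ x hx).1.differentiable (by simp) y, pd, hone.fderiv_eq]
    simp
  have hχv : ∀ x ∈ t, AEStronglyMeasurable (fun z => χ x z * v z) (vol Ω) := fun x hx =>
    (hχ x hx).1.continuous.aestronglyMeasurable.mul hv.1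
  have hχg : ∀ x ∈ t, ∀ j, AEStronglyMeasurable
      (fun z => χ x z * g j z + pd j (χ x) z * v z) (vol Ω) := fun x hx j =>
    ((hχ x hx).1.continuous.aestronglyMeasurable.mul (hg j).1).add
      ((continuous_pd (hχ x hx).1 (by simp) j).aestronglyMeasurable.mul hv.1)
  refine (IsStrongGradient.finsetSum hχv hχg fun x hx =>
    hlocal x (htK x hx) (χ x) (hχ x hx).1 (hχ x hx).2.2).congr ?_ fun j => ?_
  · filter_upwards [ae_restrict_mem hΩ.measurableSet] with y hy
    rw [Finset.sum_apply, ← Finset.sum_mul, hsum y (subset_closure hy), one_mul]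
  · filter_upwards [ae_restrict_mem hΩ.measurableSet] with y hy
    rw [Finset.sum_apply, Finset.sum_add_distrib, ← Finset.sum_mul, ← Finset.sum_mul,
      hsum y (subset_closure hy), hsum_pd y hy, one_mul, zero_mul, add_zero]

end Density

/-! ### Existence of traces -/

theorem eLpNorm_two_sq {α F : Type*} [MeasurableSpace α] [NormedAddCommGroup F] (f : α → F)
    (μ : Measure α) : eLpNorm f 2 μ ^ 2 = ∫⁻ x, ‖f x‖ₑ ^ 2 ∂μ := by
  simpa using eLpNorm_nnreal_pow_eq_lintegral (f := f) (μ := μ) (p := 2) two_ne_zero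

theorem ofReal_integral_sq {α : Type*} [MeasurableSpace α] {f : α → ℝ} {μ : Measure α}
    (hf : Integrable (fun x => f x ^ 2) μ) :
    ENNReal.ofReal (∫ x, f x ^ 2 ∂μ) = eLpNorm f 2 μ ^ 2 := by
  rw [eLpNorm_two_sq, ofReal_integral_eq_lintegral_ofReal hf (ae_of_all _ fun x => sq_nonneg _)]
  refine lintegral_congr fun x => ?_
  rw [← Real.enorm_of_nonneg (sq_nonneg (f x)), enorm_pow]

theorem eLpNorm_two_finsetSum_measure_le {ι α F : Type*} [MeasurableSpace α]
    [NormedAddCommGroup F] (f : α → F) (s : Finset ι) (μ : ι → Measure α) :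
    eLpNorm f 2 (∑ i ∈ s, μ i) ≤ ∑ i ∈ s, eLpNorm f 2 (μ i) := by
  refine (ENNReal.pow_le_pow_left_iff two_ne_zero).1 ?_
  calc eLpNorm f 2 (∑ i ∈ s, μ i) ^ 2
      = ∑ i ∈ s, eLpNorm f 2 (μ i) ^ 2 := by
        simp only [eLpNorm_two_sq, lintegral_finsetSum_measure]
    _ ≤ (∑ i ∈ s, eLpNorm f 2 (μ i)) ^ 2 := Finset.sum_sq_le_sq_sum_of_nonneg fun _ _ => zero_le

/-- The Sobolev norm `‖f‖ + ∑ⱼ ‖∂ⱼf‖` of a smooth function, with the norms of `L²(T)`; it is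
equivalent to the usual norm of `H¹(T)`. -/
def sobolevNorm (T : Set (E d)) (f : Fld d) : ENNReal :=
  eLpNorm f 2 (vol T) + ∑ j, eLpNorm (pd j f) 2 (vol T)

theorem sobolevNorm_mono {S T : Set (E d)} (hST : S ⊆ T) (f : Fld d) :
    sobolevNorm S f ≤ sobolevNorm T f := by
  have hle : vol S ≤ vol T := Measure.restrict_mono hST le_rfl
  exact add_le_add (eLpNorm_mono_measure _ hle)
    (Finset.sum_le_sum fun j _ => eLpNorm_mono_measure _ hle)

theorem ofReal_integral_sobolevSq_le {T : Set (E d)} (hT : Bornology.IsBounded T) {f : Fld d}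
    (hf : ContDiff ℝ 1 f) :
    ENNReal.ofReal (∫ x in T, sobolevSq f x) ≤ sobolevNorm T f ^ 2 := by
  have hint : Integrable (fun x => f x ^ 2) (vol T) :=
    integrable_of_continuous_of_isBounded hT (hf.continuous.pow 2)
  have hintpd : ∀ j, Integrable (fun x => pd j f x ^ 2) (vol T) := fun j =>
    integrable_of_continuous_of_isBounded hT ((continuous_pd hf one_ne_zero j).pow 2)
  calc ENNReal.ofReal (∫ x in T, sobolevSq f x)
      = eLpNorm f 2 (vol T) ^ 2 + ∑ j, eLpNorm (pd j f) 2 (vol T) ^ 2 := by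
        simp only [sobolevSq]
        rw [integral_add hint (integrable_finsetSum _ fun j _ => hintpd j),
          integral_finsetSum _ fun j _ => hintpd j,
          ENNReal.ofReal_add (integral_nonneg fun x => sq_nonneg _)
            (Finset.sum_nonneg fun j _ => integral_nonneg fun x => sq_nonneg _),
          ENNReal.ofReal_sum_of_nonneg fun j _ => integral_nonneg fun x => sq_nonneg _,
          ofReal_integral_sq hint]
        simp only [ofReal_integral_sq (hintpd _)]
    _ ≤ eLpNorm f 2 (vol T) ^ 2 + (∑ j, eLpNorm (pd j f) 2 (vol T)) ^ 2 := by
        gcongr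
        exact Finset.sum_sq_le_sq_sum_of_nonneg fun _ _ => zero_le
    _ ≤ sobolevNorm T f ^ 2 := by
        rw [sobolevNorm, add_sq]
        gcongr
        exact le_self_add

theorem FlatBoundary.exists_eLpNorm_surf_frontier_le {T : Set (E d)} (B : FlatBoundary T)
    (hT : HasLipschitzBoundary T) :
    ∃ C : ENNReal, C ≠ ⊤ ∧ ∀ f : Fld d, ContDiff ℝ 1 f →
      eLpNorm f 2 (surf (frontier T)) ≤ C * sobolevNorm T f := by
  obtain ⟨C, hC0, hC⟩ := B.exists_trace_inequality hT
  refine ⟨ENNReal.ofReal √C, ENNReal.ofReal_ne_top, fun f hf => ?_⟩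
  refine (ENNReal.pow_le_pow_left_iff two_ne_zero).1 ?_
  calc eLpNorm f 2 (surf (frontier T)) ^ 2
      = ENNReal.ofReal (∫ x, f x ^ 2 ∂(surf (frontier T))) :=
        (ofReal_integral_sq (memLp_one_iff_integrable.1
          (B.memLp_surf_frontier_of_continuous (hf.continuous.pow 2) 1))).symm
    _ ≤ ENNReal.ofReal (C * ∫ x in T, sobolevSq f x) := ENNReal.ofReal_le_ofReal (hC f hf)
    _ = ENNReal.ofReal C * ENNReal.ofReal (∫ x in T, sobolevSq f x) := ENNReal.ofReal_mul hC0
    _ ≤ ENNReal.ofReal C * sobolevNorm T f ^ 2 := by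
        gcongr
        exact ofReal_integral_sobolevSq_le B.isBounded hf
    _ = (ENNReal.ofReal √C * sobolevNorm T f) ^ 2 := by
        rw [mul_pow, ← ENNReal.ofReal_pow (Real.sqrt_nonneg C), Real.sq_sqrt hC0]

namespace PolyhedralMesh

variable {Ω : Set (E d)} (M : PolyhedralMesh Ω)

theorem isCompact_of_mem_faces {e : Set (E d)} (he : e ∈ M.faces) : IsCompact e := by
  obtain ⟨T, hT, heT⟩ := M.face_of_elem e he
  exact (M.face_flat T hT e he heT).1

theorem isCompact_skeleton : IsCompact M.skeleton :=
  M.faces.isCompact_biUnion fun _ he => M.isCompact_of_mem_faces he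

theorem frontier_subset_skeleton {T : Set (E d)} (hT : T ∈ M.elems) :
    frontier T ⊆ M.skeleton := by
  rw [M.frontier_eq T hT]
  exact Set.biUnion_subset_biUnion_left fun e he => he.1

theorem surf_skeleton_le : surf M.skeleton ≤ ∑ T ∈ M.elems, surf (frontier T) := by
  have hsub : M.skeleton ⊆ ⋃ T : M.elems, frontier (T : Set (E d)) := by
    refine Set.iUnion₂_subset fun e he => ?_
    obtain ⟨T, hT, heT⟩ := M.face_of_elem e he
    exact heT.trans (Set.subset_iUnion (fun T : M.elems => frontier (T : Set (E d))) ⟨T, hT⟩)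
  rw [← Finset.sum_coe_sort, ← Measure.sum_fintype]
  exact (Measure.restrict_mono hsub le_rfl).trans Measure.restrict_iUnion_le

theorem isFiniteMeasure_surf_skeleton : IsFiniteMeasure (surf M.skeleton) := by
  refine ⟨(Measure.le_iff'.1 M.surf_skeleton_le _).trans_lt ?_⟩
  rw [Measure.finsetSum_apply]
  refine ENNReal.sum_lt_top.2 fun T hT => ?_
  obtain ⟨B, -⟩ := M.exists_flatBoundary hT
  have := B.isFiniteMeasure_surf_frontier
  exact measure_lt_top _ _

theorem exists_eLpNorm_surf_skeleton_le :
    ∃ C : ENNReal, C ≠ ⊤ ∧ ∀ f : Fld d, ContDiff ℝ 1 f →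
      eLpNorm f 2 (surf M.skeleton) ≤ C * sobolevNorm Ω f := by
  have htrace : ∀ T ∈ M.elems, ∃ C : ENNReal, C ≠ ⊤ ∧ ∀ f : Fld d, ContDiff ℝ 1 f →
      eLpNorm f 2 (surf (frontier T)) ≤ C * sobolevNorm T f := fun T hT => by
    obtain ⟨B, -⟩ := M.exists_flatBoundary hT
    exact B.exists_eLpNorm_surf_frontier_le (M.elem_polyhedral T hT).lipschitz
  choose! C hCtop hC using htrace
  refine ⟨∑ T ∈ M.elems, C T, ENNReal.sum_ne_top.2 hCtop, fun f hf => ?_⟩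
  calc eLpNorm f 2 (surf M.skeleton)
      ≤ eLpNorm f 2 (∑ T ∈ M.elems, surf (frontier T)) := eLpNorm_mono_measure _ M.surf_skeleton_le
    _ ≤ ∑ T ∈ M.elems, eLpNorm f 2 (surf (frontier T)) := eLpNorm_two_finsetSum_measure_le _ _ _
    _ ≤ ∑ T ∈ M.elems, C T * sobolevNorm Ω f := Finset.sum_le_sum fun T hT =>
        (hC T hT f hf).trans (by gcongr; exact sobolevNorm_mono (M.elem_subset T hT) f)
    _ = (∑ T ∈ M.elems, C T) * sobolevNorm Ω f := by rw [Finset.sum_mul]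

end PolyhedralMesh

theorem PolyhedralMesh.memLp_surf_skeleton_of_continuous {Ω : Set (E d)} (M : PolyhedralMesh Ω)
    {f : Fld d} (hf : Continuous f) : MemLp f 2 (surf M.skeleton) :=
  have := M.isFiniteMeasure_surf_skeleton
  memLp_of_continuous_of_isCompact M.isCompact_skeleton hf 2

theorem pd_sub {f g : Fld d} {x : E d} (hf : DifferentiableAt ℝ f x) (hg : DifferentiableAt ℝ g x)
    (j : Fin d) : pd j (f - g) x = pd j f x - pd j g x := by
  simp only [pd, fderiv_sub hf hg, sub_apply]

theorem TendstoL2.tendsto_eLpNorm_sub {μ : Measure (E d)} {f : ℕ → Fld d} {g : Fld d}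
    (hf : ∀ m, AEStronglyMeasurable (f m) μ) (hg : AEStronglyMeasurable g μ)
    (h : TendstoL2 μ f g) :
    Tendsto (fun m : ℕ × ℕ => eLpNorm (f m.1 - f m.2) 2 μ) atTop (𝓝 0) := by
  have hsum : Tendsto (fun m : ℕ × ℕ => eLpNorm (f m.1 - g) 2 μ + eLpNorm (f m.2 - g) 2 μ)
      atTop (𝓝 0) := by
    have hadd := (h.comp (tendsto_fst (g := atTop))).add (h.comp (tendsto_snd (f := atTop)))
    rwa [add_zero, prod_atTop_atTop_eq] at hadd
  refine tendsto_of_tendsto_of_tendsto_of_le_of_le tendsto_const_nhds hsum (fun _ => zero_le)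
    fun m => ?_
  change eLpNorm (f m.1 - f m.2) 2 μ ≤ _
  rw [← sub_sub_sub_cancel_right _ _ g]
  exact eLpNorm_sub_le ((hf _).sub hg) ((hf _).sub hg) one_le_two

theorem exists_tendstoL2_of_tendsto_eLpNorm_sub {μ : Measure (E d)} {f : ℕ → Fld d}
    (hf : ∀ m, MemLp (f m) 2 μ)
    (hcauchy : Tendsto (fun m : ℕ × ℕ => eLpNorm (f m.1 - f m.2) 2 μ) atTop (𝓝 0)) :
    ∃ w : Fld d, MemLp w 2 μ ∧ TendstoL2 μ f w := by
  have hcauchyLp : CauchySeq fun m => (hf m).toLp (f m) := by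
    refine (Lp.cauchySeq_Lp_iff_cauchySeq_eLpNorm _).2 (hcauchy.congr fun m => ?_)
    exact eLpNorm_congr_ae ((hf m.1).coeFn_toLp.sub (hf m.2).coeFn_toLp).symm
  obtain ⟨w, hw⟩ := cauchySeq_tendsto_of_complete hcauchyLp
  refine ⟨w, Lp.memLp w, ((Lp.tendsto_Lp_iff_tendsto_eLpNorm' _ _).1 hw).congr fun m => ?_⟩
  exact eLpNorm_congr_ae ((hf m).coeFn_toLp.sub EventuallyEq.rfl)

theorem PolyhedralMesh.exists_tendstoL2_surf_skeleton {Ω : Set (E d)} (M : PolyhedralMesh Ω)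
    {v : Fld d} {g : Fin d → Fld d} (hv : AEStronglyMeasurable v (vol Ω))
    (hg : ∀ j, AEStronglyMeasurable (g j) (vol Ω)) {φ : ℕ → Fld d} (hφ : ∀ m, ContDiff ℝ 1 (φ m))
    (hφv : TendstoL2 (vol Ω) φ v) (hφg : ∀ j, TendstoL2 (vol Ω) (fun m => pd j (φ m)) (g j)) :
    ∃ w : Fld d, MemLp w 2 (surf M.skeleton) ∧ TendstoL2 (surf M.skeleton) φ w := by
  obtain ⟨C, hC, htrace⟩ := M.exists_eLpNorm_surf_skeleton_le
  have hsobolev : Tendsto (fun m : ℕ × ℕ => sobolevNorm Ω (φ m.1 - φ m.2)) atTop (𝓝 0) := by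
    have hvalue := hφv.tendsto_eLpNorm_sub (fun m => (hφ m).continuous.aestronglyMeasurable) hv
    have hgrad := fun j => (hφg j).tendsto_eLpNorm_sub
      (fun m => (continuous_pd (hφ m) one_ne_zero j).aestronglyMeasurable) (hg j)
    have hsum := hvalue.add (tendsto_finsetSum Finset.univ fun j _ => hgrad j)
    rw [Finset.sum_const_zero, add_zero] at hsum
    refine hsum.congr fun m => ?_
    have hpd : ∀ j, pd j (φ m.1 - φ m.2) = pd j (φ m.1) - pd j (φ m.2) := fun j => funext fun x =>
      pd_sub ((hφ _).differentiable one_ne_zero x) ((hφ _).differentiable one_ne_zero x) j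
    simp only [sobolevNorm, hpd]
  have hbound := ENNReal.Tendsto.const_mul (a := C) hsobolev (Or.inr hC)
  rw [mul_zero] at hbound
  refine exists_tendstoL2_of_tendsto_eLpNorm_sub
    (fun m => M.memLp_surf_skeleton_of_continuous (hφ m).continuous) ?_
  exact tendsto_of_tendsto_of_tendsto_of_le_of_le tendsto_const_nhds hbound (fun _ => zero_le)
    fun m => htrace _ ((hφ m.1).sub (hφ m.2))

theorem PolyhedralMesh.exists_isTrace {Ω : Set (E d)} (M : PolyhedralMesh Ω)
    (hΩ : IsPolyhedralDomain Ω) {v : Fin d → Fld d} {G : Fin d → Fin d → Fld d}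
    (h : IsH1 Ω v G) : ∃ vb, IsTrace Ω M.skeleton v G vb := by
  have hcomponent : ∀ i, ∃ w : Fld d, MemLp w 2 (surf M.skeleton) ∧ ∃ φ : ℕ → Fld d,
      (∀ m, ContDiff ℝ ∞ (φ m)) ∧ TendstoL2 (vol Ω) φ (v i) ∧
      (∀ j, TendstoL2 (vol Ω) (fun m => pd j (φ m)) (G i j)) ∧
      TendstoL2 (surf M.skeleton) φ w := fun i => by
    have hweak : IsWeakGradient Ω (v i) (G i) := h.weak i
    obtain ⟨φ, hφ, hφv, hφG⟩ := hweak.isStrongGradient hΩ.isOpen hΩ.isBounded hΩ.lipschitz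
      (h.memLp i) (h.memLp_grad i)
    obtain ⟨w, hw, hφw⟩ := M.exists_tendstoL2_surf_skeleton (h.memLp i).1
      (fun j => (h.memLp_grad i j).1) (fun m => (hφ m).of_le (by norm_cast)) hφv hφG
    exact ⟨w, hw, φ, hφ, hφv, hφG, hφw⟩
  choose vb hvb using hcomponent
  exact ⟨vb, hvb⟩

/-! ### Polynomials and their moments -/

theorem analyticOnNhd_of_mem_poly {r : ℕ} {p : Fld d} (hp : p ∈ Poly d r) :
    AnalyticOnNhd ℝ p Set.univ := by
  obtain ⟨P, -, rfl⟩ := hp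
  exact AnalyticOnNhd.eval_continuousLinearMap' (𝕜 := ℝ) (E := E d) (B := ℝ)
    (fun i => (EuclideanSpace.proj i : E d →L[ℝ] ℝ)) P

theorem contDiff_of_mem_poly {n : WithTop ℕ∞} {r : ℕ} {p : Fld d} (hp : p ∈ Poly d r) :
    ContDiff ℝ n p :=
  contDiffOn_univ.1 (analyticOnNhd_of_mem_poly hp).contDiffOn_of_completeSpace

theorem continuous_of_mem_poly {r : ℕ} {p : Fld d} (hp : p ∈ Poly d r) : Continuous p :=
  (contDiff_of_mem_poly (n := 0) hp).continuous

theorem poly_mono {r s : ℕ} (h : r ≤ s) : Poly d r ≤ Poly d s :=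
  Submodule.map_mono fun P hP => by
    rw [MvPolynomial.mem_restrictTotalDegree] at hP ⊢
    exact hP.trans h

theorem totalDegree_pderiv_le {σ R : Type*} [CommSemiring R] (j : σ) (P : MvPolynomial σ R) :
    (MvPolynomial.pderiv j P).totalDegree ≤ P.totalDegree - 1 := by
  conv_lhs => rw [P.as_sum, map_sum]
  refine MvPolynomial.totalDegree_finsetSum_le fun s hs => ?_
  rw [MvPolynomial.pderiv_monomial]
  rcases eq_or_ne (s j) 0 with hj | hj
  · simp [hj]
  · have hdegree : (s - Finsupp.single j 1).degree + 1 = s.degree := by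
      conv_rhs => rw [← tsub_add_cancel_of_le
        (Finsupp.single_le_iff.2 (Nat.one_le_iff_ne_zero.2 hj)), map_add, Finsupp.degree_single]
    refine (MvPolynomial.totalDegree_monomial_le _ _).trans (Nat.le_sub_of_add_le ?_)
    exact hdegree.le.trans (MvPolynomial.le_totalDegree hs)

theorem pd_evalLin (j : Fin d) (P : MvPolynomial (Fin d) ℝ) :
    pd j (evalLin d P) = evalLin d (MvPolynomial.pderiv j P) := by
  have hdiff : ∀ Q : MvPolynomial (Fin d) ℝ, Differentiable ℝ (evalLin d Q) := fun Q =>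
    (contDiff_of_mem_poly (n := 1) (r := Q.totalDegree) ⟨Q,
      (MvPolynomial.mem_restrictTotalDegree _ _ _).2 le_rfl, rfl⟩).differentiable one_ne_zero
  ext x
  induction P using MvPolynomial.induction_on with
  | C a =>
    have hconst : evalLin d (MvPolynomial.C a) = fun _ => a := by
      ext y
      simp [evalLin]
    simp [hconst, pd]
  | add P Q hP hQ =>
    simp only [map_add, Pi.add_apply, ← hP, ← hQ, pd, fderiv_add (hdiff P x) (hdiff Q x), add_apply]
  | mul_X P i hP =>
    have hmul : evalLin d (P * MvPolynomial.X i) = fun y => evalLin d P y * y i := by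
      ext y
      simp [evalLin]
    have hcoord : HasFDerivAt (fun y : E d => y i) (EuclideanSpace.proj i : E d →L[ℝ] ℝ) x :=
      (EuclideanSpace.proj i : E d →L[ℝ] ℝ).hasFDerivAt
    rw [hmul, pd_mul (hdiff P x) hcoord.differentiableAt, hP, Derivation.leibniz,
      MvPolynomial.pderiv_X, pd, hcoord.fderiv]
    rcases eq_or_ne i j with rfl | hij
    · have hcoord_single :
          (EuclideanSpace.proj i : E d →L[ℝ] ℝ) (EuclideanSpace.single i 1) = 1 := by simp
      simp only [evalLin, LinearMap.coe_mk, AddHom.coe_mk, hcoord_single, Pi.single_eq_same,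
        smul_eq_mul, MvPolynomial.eval_add, MvPolynomial.eval_mul, MvPolynomial.eval_X, mul_one]
      ring
    · simp [evalLin, hij, mul_comm]

theorem pd_mem_poly {r : ℕ} {p : Fld d} (hp : p ∈ Poly d r) (j : Fin d) :
    pd j p ∈ Poly d (r - 1) := by
  obtain ⟨P, hP, rfl⟩ := hp
  have hdegree : P.totalDegree ≤ r := (MvPolynomial.mem_restrictTotalDegree _ _ _).1 hP
  exact ⟨MvPolynomial.pderiv j P, (MvPolynomial.mem_restrictTotalDegree _ _ _).2
    ((totalDegree_pderiv_le j P).trans (Nat.sub_le_sub_right hdegree 1)), (pd_evalLin j P).symm⟩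

theorem integral_l2Proj_mul {μ : Measure (E d)} {r : ℕ} {f : Fld d} (hf : MemLp f 2 μ)
    (hP : ∀ q ∈ Poly d r, MemLp q 2 μ) {q : Fld d} (hq : q ∈ Poly d r) :
    ∫ x, l2Proj μ r f x * q x ∂μ = ∫ x, f x * q x ∂μ := by
  obtain ⟨hmem, horthogonal⟩ := l2Proj_spec hf hP
  have hfq : Integrable (fun x => f x * q x) μ := hf.integrable_mul (hP q hq)
  have hpq : Integrable (fun x => l2Proj μ r f x * q x) μ := (hP _ hmem).integrable_mul (hP q hq)
  rw [eq_comm, ← sub_eq_zero, ← integral_sub hfq hpq, ← horthogonal q hq]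
  simp only [sub_mul]

theorem eq_of_forall_setIntegral_mul_eq {T : Set (E d)} (hT : IsOpen T) (hne : T.Nonempty)
    (hb : Bornology.IsBounded T) {r : ℕ} {p p' : Fld d} (hp : p ∈ Poly d r) (hp' : p' ∈ Poly d r)
    (h : ∀ q ∈ Poly d r, ∫ x in T, p x * q x = ∫ x in T, p' x * q x) : p = p' := by
  have hc := continuous_of_mem_poly hp
  have hc' := continuous_of_mem_poly hp'
  have hint : ∀ {f g : Fld d}, Continuous f → Continuous g →
      Integrable (fun x => f x * g x) (vol T) := fun hf hg =>
    integrable_of_continuous_of_isBounded hb (hf.mul hg)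
  have hzero : ∫ x in T, (p x - p' x) ^ 2 = 0 := by
    rw [← sub_eq_zero.2 (h (p - p') (Submodule.sub_mem _ hp hp')),
      ← integral_sub (hint hc (hc.sub hc')) (hint hc' (hc.sub hc'))]
    simp only [Pi.sub_apply, ← sub_mul, sq]
  have hae : p =ᵐ[vol T] p' := by
    filter_upwards [(integral_eq_zero_iff_of_nonneg (fun x => sq_nonneg _)
      (integrable_of_continuous_of_isBounded hb ((hc.sub hc').pow 2))).1 hzero] with x hx
    exact sub_eq_zero.1 (sq_eq_zero_iff.1 hx)
  obtain ⟨z, hz⟩ := hne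
  exact (analyticOnNhd_of_mem_poly hp).eq_of_eventuallyEq (analyticOnNhd_of_mem_poly hp')
    ((Measure.eqOn_open_of_ae_eq hae hT hc.continuousOn hc'.continuousOn).eventuallyEq_of_mem
      (hT.mem_nhds hz))

theorem eq_l2Proj_iff {T : Set (E d)} (hT : IsOpen T) (hne : T.Nonempty)
    (hb : Bornology.IsBounded T) {r : ℕ} {f p : Fld d} (hf : MemLp f 2 (vol T)) :
    p = l2Proj (vol T) r f ↔
      p ∈ Poly d r ∧ ∀ q ∈ Poly d r, ∫ x in T, p x * q x = ∫ x in T, f x * q x := by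
  have hP : ∀ q ∈ Poly d r, MemLp q 2 (vol T) := fun q hq =>
    memLp_of_continuous_of_isBounded hb (continuous_of_mem_poly hq) 2
  have hmem := (l2Proj_spec hf hP).1
  constructor
  · rintro rfl
    exact ⟨hmem, fun q hq => integral_l2Proj_mul hf hP hq⟩
  · rintro ⟨hp, h⟩
    refine eq_of_forall_setIntegral_mul_eq hT hne hb hp hmem fun q hq => ?_
    rw [h q hq, integral_l2Proj_mul hf hP hq]

/-! ### Integration by parts in `H¹` and `H(div)` -/

/-- The distributional partial derivative `∂ⱼ` on `T` of the scalar weak function `{v, w}`, with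
interior values `v` and boundary values `w`, tested with `q`. The discrete weak gradient and
divergence represent sums of such functionals. -/
def weakDeriv (T : Set (E d)) (j : Fin d) (v w q : Fld d) : ℝ :=
  -(∫ x in T, v x * pd j q x) + ∫ x, w x * q x * outwardNormal T x j ∂(surf (frontier T))

theorem weakDeriv_congr {T : Set (E d)} (hT : MeasurableSet T) {p q : Fld d}
    (h : ∀ x ∈ closure T, p =ᶠ[𝓝 x] q) (j : Fin d) (v w : Fld d) :
    weakDeriv T j v w p = weakDeriv T j v w q := by
  refine congrArg₂ (-· + ·) (setIntegral_congr_fun hT fun x hx => ?_)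
    (setIntegral_congr_fun (isClosed_frontier (s := T)).measurableSet fun x hx => ?_)
  · simp only [pd, (h x (subset_closure hx)).fderiv_eq]
  · simp only [(h x (frontier_subset_closure hx)).self_of_nhds]

namespace FlatBoundary

variable {T : Set (E d)}

theorem setIntegral_pd_mul_eq_weakDeriv (B : FlatBoundary T) {f q : Fld d} (hf : ContDiff ℝ 1 f)
    (hq : ContDiff ℝ 1 q) (j : Fin d) : ∫ x in T, pd j f x * q x = weakDeriv T j f f q :=
  B.setIntegral_pd_mul hf hq j

theorem integrable_mul_pd (B : FlatBoundary T) {v q : Fld d} (hv : MemLp v 2 (vol T))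
    (hq : ContDiff ℝ 1 q) (j : Fin d) : Integrable (fun x => v x * pd j q x) (vol T) := by
  have hpd : MemLp (pd j q) 2 (vol T) :=
    memLp_of_continuous_of_isBounded B.isBounded (continuous_pd hq one_ne_zero j) 2
  exact hv.integrable_mul hpd

theorem integrable_mul_mul_outwardNormal (B : FlatBoundary T) {w q : Fld d}
    (hw : MemLp w 2 (surf (frontier T))) (hq : Continuous q) (j : Fin d) :
    Integrable (fun x => w x * q x * outwardNormal T x j) (surf (frontier T)) := by
  have hwq : Integrable (fun x => w x * q x) (surf (frontier T)) :=
    hw.integrable_mul (B.memLp_surf_frontier_of_continuous hq 2)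
  exact memLp_one_iff_integrable.1
    (B.memLp_mul_outwardNormal (memLp_one_iff_integrable.2 hwq) j)

theorem divergence_functional_eq_sum_weakDeriv (B : FlatBoundary T) {v w : Fin d → Fld d}
    {q : Fld d} (hv : ∀ i, MemLp (v i) 2 (vol T)) (hw : ∀ i, MemLp (w i) 2 (surf (frontier T)))
    (hq : ContDiff ℝ 1 q) :
    -(∫ x in T, ∑ i, v i x * pd i q x) +
        ∫ x, (∑ i, w i x * outwardNormal T x i) * q x ∂(surf (frontier T)) =
      ∑ i, weakDeriv T i (v i) (w i) q := by
  simp only [weakDeriv, Finset.sum_add_distrib, Finset.sum_neg_distrib, Finset.sum_mul,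
    mul_right_comm _ _ (q _)]
  rw [integral_finsetSum _ fun i _ => B.integrable_mul_pd (hv i) hq i,
    integral_finsetSum _ fun i _ => B.integrable_mul_mul_outwardNormal (hw i) hq.continuous i]

theorem gradient_functional_eq_sum_weakDeriv (B : FlatBoundary T) {v w : Fin d → Fld d}
    {q : Fin d → Fin d → Fld d} (hv : ∀ i, MemLp (v i) 2 (vol T))
    (hw : ∀ i, MemLp (w i) 2 (surf (frontier T))) (hq : ∀ i j, ContDiff ℝ 1 (q i j)) :
    -(∫ x in T, ∑ i, v i x * ∑ j, pd j (q i j) x) +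
        ∫ x, ∑ i, w i x * ∑ j, q i j x * outwardNormal T x j ∂(surf (frontier T)) =
      ∑ i, ∑ j, weakDeriv T j (v i) (w i) (q i j) := by
  have hvol := fun i j => B.integrable_mul_pd (hv i) (hq i j) j
  have hsurf := fun i j => B.integrable_mul_mul_outwardNormal (hw i) (hq i j).continuous j
  simp only [weakDeriv, Finset.sum_add_distrib, Finset.sum_neg_distrib, Finset.mul_sum,
    ← mul_assoc]
  rw [integral_finsetSum _ fun i _ => integrable_finsetSum _ fun j _ => hvol i j,
    integral_finsetSum _ fun i _ => integrable_finsetSum _ fun j _ => hsurf i j]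
  simp only [integral_finsetSum _ fun j _ => hvol _ j, integral_finsetSum _ fun j _ => hsurf _ j]

end FlatBoundary

theorem TendstoL2.tendsto_integral_mul {μ : Measure (E d)} {f : ℕ → Fld d} {g w : Fld d}
    (h : TendstoL2 μ f g) (hf : ∀ m, MemLp (f m) 2 μ) (hg : MemLp g 2 μ) (hw : MemLp w 2 μ) :
    Tendsto (fun m => ∫ x, f m x * w x ∂μ) atTop (𝓝 (∫ x, g x * w x ∂μ)) := by
  refine tendsto_integral_of_L1' _ (hg.integrable_mul hw).1
    (Eventually.of_forall fun m => (hf m).integrable_mul hw) ?_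
  have hprod : Tendsto (fun m => eLpNorm (fun x => f m x - g x) 2 μ * eLpNorm w 2 μ) atTop
      (𝓝 0) := by
    simpa using ENNReal.Tendsto.mul_const (b := eLpNorm w 2 μ) h (Or.inr hw.2.ne)
  refine tendsto_of_tendsto_of_tendsto_of_le_of_le tendsto_const_nhds hprod (fun _ => zero_le)
    fun m => ?_
  have hholder := eLpNorm_smul_le_mul_eLpNorm (p := 2) (q := 2) (r := 1) hw.1
    ((hf m).1.sub hg.1)
  refine le_of_eq_of_le (congrArg (eLpNorm · 1 μ) (funext fun x => ?_)) hholder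
  exact (sub_mul (f m x) (g x) (w x)).symm

theorem FlatBoundary.tendsto_weakDeriv {T : Set (E d)} (B : FlatBoundary T) {φ : ℕ → Fld d}
    {v w q : Fld d} (hφ : ∀ m, Continuous (φ m)) (hv : MemLp v 2 (vol T))
    (hw : MemLp w 2 (surf (frontier T))) (hφv : TendstoL2 (vol T) φ v)
    (hφw : TendstoL2 (surf (frontier T)) φ w) (hq : ContDiff ℝ 1 q) (j : Fin d) :
    Tendsto (fun m => weakDeriv T j (φ m) (φ m) q) atTop (𝓝 (weakDeriv T j v w q)) := by
  have hvol := hφv.tendsto_integral_mul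
    (fun m => memLp_of_continuous_of_isBounded B.isBounded (hφ m) 2) hv
    (memLp_of_continuous_of_isBounded B.isBounded (continuous_pd hq one_ne_zero j) 2)
  have hsurf := hφw.tendsto_integral_mul
    (fun m => B.memLp_surf_frontier_of_continuous (hφ m) 2) hw
    (B.memLp_mul_outwardNormal (B.memLp_surf_frontier_of_continuous hq.continuous 2) j)
  simpa only [weakDeriv, mul_assoc] using hvol.neg.add hsurf

theorem PolyhedralMesh.memLp_surf_frontier {Ω : Set (E d)} (M : PolyhedralMesh Ω) {T : Set (E d)}
    (hT : T ∈ M.elems) {w : Fld d} (hw : MemLp w 2 (surf M.skeleton)) :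
    MemLp w 2 (surf (frontier T)) :=
  hw.mono_measure (Measure.restrict_mono (M.frontier_subset_skeleton hT) le_rfl)

theorem IsTrace.setIntegral_mul_eq_weakDeriv {Ω : Set (E d)} {M : PolyhedralMesh Ω}
    {v : Fin d → Fld d} {G : Fin d → Fin d → Fld d} {vb : Fin d → Fld d}
    (hvb : IsTrace Ω M.skeleton v G vb) (hv : IsH1 Ω v G) {T : Set (E d)} (hT : T ∈ M.elems)
    {q : Fld d} (hq : ContDiff ℝ 1 q) (i j : Fin d) :
    ∫ x in T, G i j x * q x = weakDeriv T j (v i) (vb i) q := by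
  obtain ⟨B, -⟩ := M.exists_flatBoundary hT
  obtain ⟨hvbL2, φ, hφ, hφv, hφG, hφvb⟩ := hvb i
  have hφ1 : ∀ m, ContDiff ℝ 1 (φ m) := fun m => (hφ m).of_le (by norm_cast)
  have hvol : vol T ≤ vol Ω := Measure.restrict_mono (M.elem_subset T hT) le_rfl
  have hsurf : surf (frontier T) ≤ surf M.skeleton :=
    Measure.restrict_mono (M.frontier_subset_skeleton hT) le_rfl
  have hgrad := ((hφG j).mono_measure hvol).tendsto_integral_mul
    (fun m => memLp_of_continuous_of_isBounded B.isBounded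
      (continuous_pd (hφ1 m) one_ne_zero j) 2)
    ((hv.memLp_grad i j).mono_measure hvol)
    (memLp_of_continuous_of_isBounded B.isBounded hq.continuous 2)
  simp only [B.setIntegral_pd_mul_eq_weakDeriv (hφ1 _) hq] at hgrad
  exact tendsto_nhds_unique hgrad (B.tendsto_weakDeriv (fun m => (hφ m).continuous)
    ((hv.memLp i).mono_measure hvol) (hvbL2.mono_measure hsurf) (hφv.mono_measure hvol)
    (hφvb.mono_measure hsurf) hq j)

theorem IsNormalTrace.setIntegral_mul_eq_of_isTest {T : Set (E d)} {v vb : Fin d → Fld d}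
    {D : Fld d} (hvb : IsNormalTrace T v D vb) (B : FlatBoundary T)
    (hv : ∀ i, MemLp (v i) 2 (vol T)) (hD : MemLp D 2 (vol T)) {ψ : Fld d}
    (hψ : IsTest Set.univ ψ) :
    ∫ x in T, D x * ψ x = -(∫ x in T, ∑ i, v i x * pd i ψ x) +
      ∫ x, (∑ i, vb i x * outwardNormal T x i) * ψ x ∂(surf (frontier T)) := by
  obtain ⟨φ, hφ, hφv, hφD, hφvb⟩ := hvb
  have hφ1 : ∀ m i, ContDiff ℝ 1 (φ m i) := fun m i => (hφ m i).of_le (by norm_cast)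
  have hψ1 : ContDiff ℝ 1 ψ := hψ.1.of_le (by norm_cast)
  have hvol : ∀ {f : Fld d}, Continuous f → MemLp f 2 (vol T) := fun hf =>
    memLp_of_continuous_of_isBounded B.isBounded hf 2
  have hdiv := hφD.tendsto_integral_mul (fun m => hvol (continuous_finsetSum _ fun i _ =>
    continuous_pd (hφ1 m i) one_ne_zero i)) hD (hvol hψ1.continuous)
  have hgrad := tendsto_finsetSum Finset.univ fun i (_ : i ∈ Finset.univ) =>
    (hφv i).tendsto_integral_mul (fun m => hvol (hφ m i).continuous) (hv i)
      (hvol (continuous_pd hψ1 one_ne_zero i))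
  have hgreen : ∀ m, ∫ x in T, (∑ i, pd i (φ m i) x) * ψ x =
      -(∑ i, ∫ x in T, φ m i x * pd i ψ x) +
        ∫ x, (∑ i, φ m i x * outwardNormal T x i) * ψ x ∂(surf (frontier T)) := fun m => by
    have hφL2 := fun i => hvol (hφ m i).continuous
    rw [← integral_finsetSum _ fun i _ => B.integrable_mul_pd (hφL2 i) hψ1 i,
      B.divergence_functional_eq_sum_weakDeriv hφL2
        (fun i => B.memLp_surf_frontier_of_continuous (hφ m i).continuous 2) hψ1]
    simp only [Finset.sum_mul, ← B.setIntegral_pd_mul_eq_weakDeriv (hφ1 m _) hψ1]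
    exact integral_finsetSum _ fun i _ => integrable_of_continuous_of_isBounded B.isBounded
      ((continuous_pd (hφ1 m i) one_ne_zero i).mul hψ1.continuous)
  rw [integral_finsetSum _ fun i _ => B.integrable_mul_pd (hv i) hψ1 i]
  simp only [hgreen] at hdiv
  exact tendsto_nhds_unique hdiv (hgrad.neg.add (hφvb ψ hψ))

theorem IsNormalTrace.setIntegral_mul_eq_sum_weakDeriv {T : Set (E d)} {v vb : Fin d → Fld d}
    {D : Fld d} (hvb : IsNormalTrace T v D vb) (B : FlatBoundary T)
    (hv : ∀ i, MemLp (v i) 2 (vol T)) (hD : MemLp D 2 (vol T))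
    (hvbL2 : ∀ i, MemLp (vb i) 2 (surf (frontier T))) {q : Fld d} (hq : ContDiff ℝ ∞ q) :
    ∫ x in T, D x * q x = ∑ i, weakDeriv T i (v i) (vb i) q := by
  obtain ⟨ψ, hψ, hψc, hψq⟩ := exists_hasCompactSupport_eventuallyEq B.isBounded hq
  have hT : MeasurableSet T := B.isOpen.measurableSet
  calc ∫ x in T, D x * q x
      = ∫ x in T, D x * ψ x := setIntegral_congr_fun hT fun x hx => by
        simp only [(hψq x (subset_closure hx)).self_of_nhds]
    _ = ∑ i, weakDeriv T i (v i) (vb i) ψ := by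
        rw [hvb.setIntegral_mul_eq_of_isTest B hv hD ⟨hψ, hψc, Set.subset_univ _⟩,
          B.divergence_functional_eq_sum_weakDeriv hv hvbL2 (hψ.of_le (by norm_cast))]
    _ = ∑ i, weakDeriv T i (v i) (vb i) q :=
        Finset.sum_congr rfl fun i _ => weakDeriv_congr hT hψq i _ _

/-! ### The discrete weak operators -/

theorem FlatBoundary.isDiscreteWeakDivergence_iff_eq_l2Proj {T : Set (E d)} (B : FlatBoundary T)
    (hne : T.Nonempty) {r : ℕ} {v w : Fin d → Fld d} {D : Fld d}
    (hv : ∀ i, MemLp (v i) 2 (vol T)) (hw : ∀ i, MemLp (w i) 2 (surf (frontier T)))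
    (hD : MemLp D 2 (vol T))
    (hweak : ∀ q ∈ Poly d r, ∫ x in T, D x * q x = ∑ i, weakDeriv T i (v i) (w i) q) (p : Fld d) :
    IsDiscreteWeakDivergence T r v w p ↔ p = l2Proj (vol T) r D := by
  rw [eq_l2Proj_iff B.isOpen hne B.isBounded hD, IsDiscreteWeakDivergence]
  refine and_congr_right fun _ => forall₂_congr fun q hq => ?_
  rw [B.divergence_functional_eq_sum_weakDeriv hv hw (contDiff_of_mem_poly hq), hweak q hq]

theorem forall_sum_sum_eq_iff {ι κ α N : Type*} [Fintype ι] [Fintype κ] [Zero α] [AddCommMonoid N]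
    {S : Set α} (hS : 0 ∈ S) {F G : ι → κ → α → N} (hF : ∀ i j, F i j 0 = 0)
    (hG : ∀ i j, G i j 0 = 0) :
    (∀ q : ι → κ → α, (∀ i j, q i j ∈ S) →
        ∑ i, ∑ j, F i j (q i j) = ∑ i, ∑ j, G i j (q i j)) ↔
      ∀ i j, ∀ p ∈ S, F i j p = G i j p := by
  classical
  refine ⟨fun h i j p hp => ?_, fun h q hq => Finset.sum_congr rfl fun i _ =>
    Finset.sum_congr rfl fun j _ => h i j _ (hq i j)⟩
  let q : ι → κ → α := fun i' j' => if i' = i ∧ j' = j then p else 0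
  have hq : ∀ i' j', q i' j' ∈ S := fun i' j' => by
    by_cases hij : i' = i ∧ j' = j <;> simp [q, hij, hp, hS]
  have hsum : ∀ H : ι → κ → α → N, (∀ i j, H i j 0 = 0) →
      ∑ i', ∑ j', H i' j' (q i' j') = H i j p := fun H hH => by
    rw [Fintype.sum_eq_single i fun i' hi => Finset.sum_eq_zero fun j' _ => by simp [q, hi, hH],
      Fintype.sum_eq_single j fun j' hj => by simp [q, hj, hH]]
    simp [q]
  simpa only [hsum F hF, hsum G hG] using h q hq

theorem weakDeriv_zero (T : Set (E d)) (j : Fin d) (v w : Fld d) : weakDeriv T j v w 0 = 0 := by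
  simp [weakDeriv, pd]

theorem FlatBoundary.isDiscreteWeakGradient_iff_forall {T : Set (E d)} (B : FlatBoundary T)
    {r : ℕ} {v w : Fin d → Fld d} (hv : ∀ i, MemLp (v i) 2 (vol T))
    (hw : ∀ i, MemLp (w i) 2 (surf (frontier T))) (A : Fin d → Fin d → Fld d) :
    IsDiscreteWeakGradient T r v w A ↔ ∀ i j, A i j ∈ Poly d r ∧
      ∀ q ∈ Poly d r, ∫ x in T, A i j x * q x = weakDeriv T j (v i) (w i) q := by
  simp only [forall_and, IsDiscreteWeakGradient]
  refine and_congr_right fun hA => ?_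
  refine Iff.trans (forall₂_congr fun q hq => ?_) (forall_sum_sum_eq_iff (S := Poly d r)
    (F := fun i j q => ∫ x in T, A i j x * q x) (Submodule.zero_mem _) (by simp)
    (fun i j => weakDeriv_zero T j (v i) (w i)))
  have hint : ∀ i j, Integrable (fun x => A i j x * q i j x) (vol T) := fun i j =>
    integrable_of_continuous_of_isBounded B.isBounded
      ((continuous_of_mem_poly (hA i j)).mul (continuous_of_mem_poly (hq i j)))
  rw [B.gradient_functional_eq_sum_weakDeriv hv hw fun i j => contDiff_of_mem_poly (hq i j),
    integral_finsetSum _ fun i _ => integrable_finsetSum _ fun j _ => hint i j]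
  simp only [integral_finsetSum _ fun j _ => hint _ j]

theorem FlatBoundary.isDiscreteWeakGradient_iff_eq_projMatrix {T : Set (E d)}
    (B : FlatBoundary T) (hne : T.Nonempty) {r : ℕ} {v w : Fin d → Fld d}
    {G : Fin d → Fin d → Fld d} (hv : ∀ i, MemLp (v i) 2 (vol T))
    (hw : ∀ i, MemLp (w i) 2 (surf (frontier T))) (hG : ∀ i j, MemLp (G i j) 2 (vol T))
    (hweak : ∀ i j, ∀ q ∈ Poly d r, ∫ x in T, G i j x * q x = weakDeriv T j (v i) (w i) q)
    (A : Fin d → Fin d → Fld d) :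
    IsDiscreteWeakGradient T r v w A ↔ A = projMatrix T r G := by
  rw [B.isDiscreteWeakGradient_iff_forall hv hw, funext_iff]
  simp only [funext_iff (f := A _)]
  refine forall₂_congr fun i j => ?_
  rw [projMatrix, eq_l2Proj_iff B.isOpen hne B.isBounded (hG i j)]
  exact and_congr_right fun _ => forall₂_congr fun q hq => by rw [hweak i j q hq]

/-! ### Commutation with the projections -/

namespace PolyhedralMesh

variable {Ω : Set (E d)} (M : PolyhedralMesh Ω)

theorem surf_le_surf_skeleton {e : Set (E d)} (he : e ∈ M.faces) : surf e ≤ surf M.skeleton :=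
  Measure.restrict_mono (Set.subset_biUnion_of_mem (u := fun e => e) he) le_rfl

theorem memLp_surf_face_of_mem_poly {e : Set (E d)} (he : e ∈ M.faces) {r : ℕ} {q : Fld d}
    (hq : q ∈ Poly d r) : MemLp q 2 (surf e) :=
  (M.memLp_surf_skeleton_of_continuous (continuous_of_mem_poly hq)).mono_measure
    (M.surf_le_surf_skeleton he)

theorem projFaces_ae_eq {e : Set (E d)} (he : e ∈ M.faces) (s : ℕ) (vb : Fin d → Fld d)
    (i : Fin d) : M.projFaces s vb i =ᵐ[surf e] l2Proj (surf e) s (vb i) := by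
  have hothers : ∀ᵐ x ∂(surf e), ∀ e' ∈ M.faces, e' ≠ e → x ∉ e' := by
    refine (Finset.eventually_all M.faces).2 fun e' he' => ?_
    by_cases hne : e' = e
    · simp [hne]
    · filter_upwards [measure_eq_zero_iff_ae_notMem.1
        (M.face_overlap e he e' he' (Ne.symm hne))] with x hx _ using hx
  filter_upwards [hothers, ae_restrict_mem (M.isCompact_of_mem_faces he).measurableSet]
    with x hx hxe
  rw [projFaces, Finset.sum_eq_single_of_mem e he fun e' he' hne =>
    Set.indicator_of_notMem (hx e' he' hne) _, Set.indicator_of_mem hxe]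

theorem memLp_projFaces {s : ℕ} {vb : Fin d → Fld d} {i : Fin d}
    (hvb : MemLp (vb i) 2 (surf M.skeleton)) :
    MemLp (M.projFaces s vb i) 2 (surf M.skeleton) :=
  memLp_finsetSum _ fun _ he =>
    (M.memLp_surf_skeleton_of_continuous (continuous_of_mem_poly
      (l2Proj_spec (hvb.mono_measure (M.surf_le_surf_skeleton he))
        fun _ hq => M.memLp_surf_face_of_mem_poly he hq).1)).indicator
      (M.isCompact_of_mem_faces he).measurableSet

theorem integral_surf_face_projFaces_mul {e : Set (E d)} (he : e ∈ M.faces) {s : ℕ}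
    {vb : Fin d → Fld d} {i : Fin d} (hvb : MemLp (vb i) 2 (surf M.skeleton)) {q : Fld d}
    (hq : q ∈ Poly d s) :
    ∫ x, M.projFaces s vb i x * q x ∂(surf e) = ∫ x, vb i x * q x ∂(surf e) := by
  rw [← integral_l2Proj_mul (hvb.mono_measure (M.surf_le_surf_skeleton he))
    (fun _ hp => M.memLp_surf_face_of_mem_poly he hp) hq]
  refine integral_congr_ae ?_
  filter_upwards [M.projFaces_ae_eq he s vb i] with x hx
  rw [hx]

theorem memLp_projElem {T : Set (E d)} (hT : T ∈ M.elems) {k : ℕ} {v : Fin d → Fld d} {i : Fin d}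
    (hv : MemLp (v i) 2 (vol T)) : MemLp (projElem T k v i) 2 (vol T) := by
  have hP : ∀ q ∈ Poly d k, MemLp q 2 (vol T) := fun q hq =>
    memLp_of_continuous_of_isBounded (M.elem_polyhedral T hT).isBounded
      (continuous_of_mem_poly hq) 2
  exact hP _ (l2Proj_spec hv hP).1

theorem weakDeriv_proj {T : Set (E d)} (hT : T ∈ M.elems) {k r s : ℕ} (hr : r ≤ k + 1)
    (hs : r ≤ s) {v vb : Fin d → Fld d} {i : Fin d} (hv : MemLp (v i) 2 (vol T))
    (hvb : MemLp (vb i) 2 (surf M.skeleton)) {q : Fld d} (hq : q ∈ Poly d r) (j : Fin d) :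
    weakDeriv T j (projElem T k v i) (M.projFaces s vb i) q = weakDeriv T j (v i) (vb i) q := by
  obtain ⟨B, hB⟩ := M.exists_flatBoundary hT
  have hpd : pd j q ∈ Poly d k := poly_mono (by omega) (pd_mem_poly hq j)
  have hqL2 : MemLp q 2 (surf (frontier T)) :=
    B.memLp_surf_frontier_of_continuous (continuous_of_mem_poly hq) 2
  have hproj : Integrable (fun x => M.projFaces s vb i x * q x) (surf (frontier T)) :=
    (M.memLp_surf_frontier hT (M.memLp_projFaces hvb)).integrable_mul hqL2
  have hvbq : Integrable (fun x => vb i x * q x) (surf (frontier T)) :=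
    (M.memLp_surf_frontier hT hvb).integrable_mul hqL2
  refine congrArg₂ (-· + ·) (integral_l2Proj_mul hv (fun p hp =>
    memLp_of_continuous_of_isBounded B.isBounded (continuous_of_mem_poly hp) 2) hpd) ?_
  rw [B.integral_mul_outwardNormal hproj, B.integral_mul_outwardNormal hvbq]
  exact Finset.sum_congr rfl fun e he => by
    rw [M.integral_surf_face_projFaces_mul (hB he) hvb (poly_mono hs hq)]

theorem isDiscreteWeakGradient_proj_iff {T : Set (E d)} (hT : T ∈ M.elems) {k r s : ℕ}
    (hr : r ≤ k + 1) (hs : r ≤ s) {v vb : Fin d → Fld d} {G : Fin d → Fin d → Fld d}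
    (hv : IsH1 Ω v G) (hvb : IsTrace Ω M.skeleton v G vb) (A : Fin d → Fin d → Fld d) :
    IsDiscreteWeakGradient T r (projElem T k v) (M.projFaces s vb) A ↔ A = projMatrix T r G := by
  obtain ⟨B, -⟩ := M.exists_flatBoundary hT
  have hvol : vol T ≤ vol Ω := Measure.restrict_mono (M.elem_subset T hT) le_rfl
  have hvT := fun i => (hv.memLp i).mono_measure hvol
  refine B.isDiscreteWeakGradient_iff_eq_projMatrix (M.elem_polyhedral T hT).isConnected.nonempty
    (fun i => M.memLp_projElem hT (hvT i))
    (fun i => M.memLp_surf_frontier hT (M.memLp_projFaces (hvb i).1))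
    (fun i j => (hv.memLp_grad i j).mono_measure hvol) (fun i j q hq => ?_) A
  rw [M.weakDeriv_proj hT hr hs (hvT i) (hvb i).1 hq,
    hvb.setIntegral_mul_eq_weakDeriv hv hT (contDiff_of_mem_poly hq)]

theorem isDiscreteWeakDivergence_proj_iff {T : Set (E d)} (hT : T ∈ M.elems) {k r s : ℕ}
    (hr : r ≤ k + 1) (hs : r ≤ s) {v vb : Fin d → Fld d} {D : Fld d}
    (hv : ∀ i, MemLp (v i) 2 (vol T)) (hvb : ∀ i, MemLp (vb i) 2 (surf M.skeleton))
    (hD : MemLp D 2 (vol T))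
    (hgreen : ∀ q ∈ Poly d r, ∫ x in T, D x * q x = ∑ i, weakDeriv T i (v i) (vb i) q)
    (p : Fld d) :
    IsDiscreteWeakDivergence T r (projElem T k v) (M.projFaces s vb) p ↔
      p = l2Proj (vol T) r D := by
  obtain ⟨B, -⟩ := M.exists_flatBoundary hT
  refine B.isDiscreteWeakDivergence_iff_eq_l2Proj (M.elem_polyhedral T hT).isConnected.nonempty
    (fun i => M.memLp_projElem hT (hv i))
    (fun i => M.memLp_surf_frontier hT (M.memLp_projFaces (hvb i))) hD (fun q hq => ?_) p
  simp only [hgreen q hq, M.weakDeriv_proj hT hr hs (hv _) (hvb _) hq]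

theorem isDiscreteWeakDivergence_proj_iff_of_isTrace {T : Set (E d)} (hT : T ∈ M.elems)
    {k r s : ℕ} (hr : r ≤ k + 1) (hs : r ≤ s) {v vb : Fin d → Fld d}
    {G : Fin d → Fin d → Fld d} (hv : IsH1 Ω v G) (hvb : IsTrace Ω M.skeleton v G vb)
    (p : Fld d) :
    IsDiscreteWeakDivergence T r (projElem T k v) (M.projFaces s vb) p ↔
      p = l2Proj (vol T) r (fun x => ∑ i, G i i x) := by
  have hvol : vol T ≤ vol Ω := Measure.restrict_mono (M.elem_subset T hT) le_rfl
  have hG : ∀ i, MemLp (G i i) 2 (vol T) := fun i => (hv.memLp_grad i i).mono_measure hvol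
  refine M.isDiscreteWeakDivergence_proj_iff hT hr hs (fun i => (hv.memLp i).mono_measure hvol)
    (fun i => (hvb i).1) (memLp_finsetSum _ fun i _ => hG i) (fun q hq => ?_) p
  have hqL2 : MemLp q 2 (vol T) := memLp_of_continuous_of_isBounded
    (M.elem_polyhedral T hT).isBounded (continuous_of_mem_poly hq) 2
  simp only [Finset.sum_mul,
    ← hvb.setIntegral_mul_eq_weakDeriv hv hT (contDiff_of_mem_poly hq)]
  exact integral_finsetSum _ fun i _ => (hG i).integrable_mul hqL2

theorem isDiscreteWeakDivergence_proj_iff_of_isNormalTrace {T : Set (E d)} (hT : T ∈ M.elems)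
    {k r s : ℕ} (hr : r ≤ k + 1) (hs : r ≤ s) {v vb : Fin d → Fld d} {D : Fld d}
    (hv : ∀ i, MemLp (v i) 2 (vol T)) (hD : MemLp D 2 (vol T))
    (hvbL2 : ∀ i, MemLp (vb i) 2 (surf M.skeleton)) (hvb : IsNormalTrace T v D vb) (p : Fld d) :
    IsDiscreteWeakDivergence T r (projElem T k v) (M.projFaces s vb) p ↔
      p = l2Proj (vol T) r D := by
  obtain ⟨B, -⟩ := M.exists_flatBoundary hT
  exact M.isDiscreteWeakDivergence_proj_iff hT hr hs hv hvbL2 hD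
    (fun q hq => hvb.setIntegral_mul_eq_sum_weakDeriv B hv hD
      (fun i => M.memLp_surf_frontier hT (hvbL2 i)) (contDiff_of_mem_poly hq)) p

end PolyhedralMesh

end WG

end

theorem mainTheorem5_general {d : ℕ} {Ω : Set (WG.E d)} (hΩ : WG.IsPolyhedralDomain Ω)
    (M : WG.PolyhedralMesh Ω) {k r s : ℕ} (hr : r ≤ k + 1) (hs : r ≤ s) :
    (∀ (v : Fin d → WG.Fld d) (G : Fin d → Fin d → WG.Fld d), WG.IsH1 Ω v G →
      (∃ vb, WG.IsTrace Ω M.skeleton v G vb) ∧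
      ∀ vb, WG.IsTrace Ω M.skeleton v G vb → ∀ T ∈ M.elems,
        (∀ A, WG.IsDiscreteWeakGradient T r (WG.projElem T k v) (M.projFaces s vb) A ↔
          A = WG.projMatrix T r G) ∧
        (∀ p, WG.IsDiscreteWeakDivergence T r (WG.projElem T k v) (M.projFaces s vb) p ↔
          p = WG.l2Proj (WG.vol T) r (fun x => ∑ i, G i i x))) ∧
    (∀ (v : Fin d → WG.Fld d) (D : WG.Fld d), WG.IsHdiv Ω v D →
      ∀ vb : Fin d → WG.Fld d, (∀ i, MemLp (vb i) 2 (WG.surf M.skeleton)) →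
      (∀ T ∈ M.elems, WG.IsNormalTrace T v D vb) → ∀ T ∈ M.elems,
        ∀ p, WG.IsDiscreteWeakDivergence T r (WG.projElem T k v) (M.projFaces s vb) p ↔
          p = WG.l2Proj (WG.vol T) r D) := by
  have hvol : ∀ T ∈ M.elems, WG.vol T ≤ WG.vol Ω := fun T hT =>
    Measure.restrict_mono (M.elem_subset T hT) le_rfl
  exact ⟨fun v G hv => ⟨M.exists_isTrace hΩ hv, fun vb hvb T hT =>
      ⟨M.isDiscreteWeakGradient_proj_iff hT hr hs hv hvb,
        M.isDiscreteWeakDivergence_proj_iff_of_isTrace hT hr hs hv hvb⟩⟩,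
    fun v D hv vb hvbL2 hvb T hT => M.isDiscreteWeakDivergence_proj_iff_of_isNormalTrace hT hr hs
      (fun i => (hv.memLp i).mono_measure (hvol T hT)) (hv.memLp_div.mono_measure (hvol T hT))
      hvbL2 (hvb T hT)⟩

theorem mainTheorem5 (d : ℕ) (hd : d = 2 ∨ d = 3) (Ω : Set (WG.E d))
    (hΩ : WG.IsPolyhedralDomain Ω) (M : WG.PolyhedralMesh Ω) (k : ℕ) (hk : 1 ≤ k) :
    (∀ (v : Fin d → WG.Fld d) (G : Fin d → Fin d → WG.Fld d), WG.IsH1 Ω v G →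
      (∃ vb, WG.IsTrace Ω M.skeleton v G vb) ∧
      ∀ vb, WG.IsTrace Ω M.skeleton v G vb → ∀ T ∈ M.elems,
        (∀ A, WG.IsDiscreteWeakGradient T (k - 1) (WG.projElem T k v) (M.projFaces (k - 1) vb) A ↔
          A = WG.projMatrix T (k - 1) G) ∧
        (∀ p, WG.IsDiscreteWeakDivergence T (k - 1) (WG.projElem T k v)
            (M.projFaces (k - 1) vb) p ↔
          p = WG.l2Proj (WG.vol T) (k - 1) (fun x => ∑ i, G i i x))) ∧
    (∀ (v : Fin d → WG.Fld d) (D : WG.Fld d), WG.IsHdiv Ω v D →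
      ∀ vb : Fin d → WG.Fld d, (∀ i, MemLp (vb i) 2 (WG.surf M.skeleton)) →
      (∀ T ∈ M.elems, WG.IsNormalTrace T v D vb) → ∀ T ∈ M.elems,
        ∀ p, WG.IsDiscreteWeakDivergence T (k - 1) (WG.projElem T k v)
            (M.projFaces (k - 1) vb) p ↔
          p = WG.l2Proj (WG.vol T) (k - 1) D) :=
  mainTheorem5_general hΩ M (by omega) le_rfl
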